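/- Let $n\ge 2$, let $I\subset\mathbb R$ be an open interval, let $\rho>0$, and let $\mathbb B^n(\rho)\subset\mathbb R^n$ be the open Euclidean ball of radius $\rho$ centred at the origin. On $M=I\times\mathbb B^n(\rho)$ write $x=(x^0,\bar x)$ with $\bar x=(x^1,\dots,x^n)$ for points and $y=(y^0,\bar y)$ with $\bar y=(y^1,\dots,y^n)$ for tangent vectors. Let $F:TM=M\times\mathbb R^{n+1}\to[0,\infty)$ be a (regular) Finsler metric: $F$ is $C^\infty$ on $\{(x,y)\in TM: y\ne 0\}$, and for every $x\in M$ the function $F(x,\cdot)$ vanishes at $0$, is positive on $\mathbb R^{n+1}\setminus\{0\}$, satisfies $F(x,\lambda y)=\lambda F(x,y)$ for $\lambda>0$, and has positive definite matrix $g_{AB}=\tfrac12\,\partial^2(F^2)/\partial y^A\partial y^B$ at every $y\neq 0$ $(0\le A,B\le n)$. Suppose that there is a function $\phi$ of three real variables such that $$F(x,y)=|\bar y|\,\phi(x^0,r,z),\qquad r=|\bar x|,\quad z=\frac{y^0}{|\bar y|},$$ for all $x\in M$ and all $y$ with $\bar y\ne 0$. Let (summing over repeated indices) $$G^A=\tfrac14\,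 g^{AB}\left(\frac{\partial^2 (F^2)}{\partial x^C\partial y^B}\,y^C-\frac{\partial (F^2)}{\partial x^B}\right)$$ be the geodesic coefficients of $F$, where $(g^{AB})$ is the inverse matrix of $(g_{AB})$, and let $$B^A_{BCD}=\frac{\partial^3G^A}{\partial y^B\partial y^C\partial y^D},\qquad L_{ABC}=-\frac14\,\frac{\partial (F^2)}{\partial y^D}\,\frac{\partial^3G^D}{\partial y^A\partial y^B\partial y^C}$$ be its Berwald and Landsberg curvatures. Then $F$ is a Landsberg metric, i.e. $L_{ABC}(x,y)=0$ for all $x\in M$, $y\ne0$ and all $A,B,C$, if and only if $F$ is a Berwald metric, i.e. $B^A_{BCD}(x,y)=0$ for all $x\in M$, $y\neq 0$ and all $A,B,C,D$. -/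

import Mathlib

open scoped ContDiff

noncomputable section

namespace Finsler

/-- Coordinates `(x^0, x^1, ..., x^n)` of a point of `ℝ × ℝⁿ`, and likewise the components
`(y^0, y^1, ..., y^n)` of a tangent vector. -/
abbrev Coord (n : ℕ) : Type := Fin (n + 1) → ℝ

/-- The spatial part `(x^1, ..., x^n)` as a vector of the Euclidean space `ℝⁿ`. -/
def spatial {n : ℕ} (x : Coord n) : EuclideanSpace ℝ (Fin n) :=
  WithLp.toLp 2 (fun i : Fin n => x i.succ)

/-- The open set `I × 𝔹ⁿ(ρ)`. -/
def cylinder (n : ℕ) (I : Set ℝ) (ρ : ℝ) : Set (Coord n) :=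
  {x | x 0 ∈ I ∧ spatial x ∈ Metric.ball (0 : EuclideanSpace ℝ (Fin n)) ρ}

/-- The partial derivative `∂f/∂v^A` at `v`. -/
def pd {n : ℕ} (A : Fin (n + 1)) (f : Coord n → ℝ) (v : Coord n) : ℝ :=
  fderiv ℝ f v (Pi.single A 1)

/-- The matrix `g_{AB} = ½ ∂²(f²)/∂y^A∂y^B` of a function `f` on a tangent space. -/
def fundamentalMatrix {n : ℕ} (f : Coord n → ℝ) (y : Coord n) :
    Matrix (Fin (n + 1)) (Fin (n + 1)) ℝ :=
  Matrix.of fun A B => (1 / 2 : ℝ) * pd A (pd B (fun w => f w ^ 2)) y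

/-- Minkowski norms: smooth away from the origin, positive definite, positively homogeneous of
degree one, and strongly convex. Reversibility `f (-y) = f y` is not required. -/
structure IsMinkowskiNorm {n : ℕ} (f : Coord n → ℝ) : Prop where
  smooth : ContDiffOn ℝ ∞ f {0}ᶜ
  map_zero : f 0 = 0
  pos : ∀ y, y ≠ 0 → 0 < f y
  homogeneous : ∀ (c : ℝ) (y : Coord n), 0 < c → f (c • y) = c * f y
  stronglyConvex : ∀ y, y ≠ 0 → (fundamentalMatrix f y).PosDef

/-- `F` is a (regular) Finsler metric on the open set `M`, whose tangent bundle is `M × ℝ^{n+1}`: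
`F` is smooth on the whole slit tangent bundle, and each `F x` is a Minkowski norm. -/
structure IsFinslerMetric {n : ℕ} (M : Set (Coord n)) (F : Coord n → Coord n → ℝ) : Prop where
  smooth : ContDiffOn ℝ ∞ (fun p : Coord n × Coord n => F p.1 p.2) (M ×ˢ {0}ᶜ)
  minkowski : ∀ x ∈ M, IsMinkowskiNorm (F x)

/-- The geodesic (spray) coefficients
`G^A = ¼ g^{AB} ( (∂²(F²)/∂x^C∂y^B) y^C - ∂(F²)/∂x^B )`. -/
def spray {n : ℕ} (F : Coord n → Coord n → ℝ) (A : Fin (n + 1)) (x y : Coord n) : ℝ :=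
  (1 / 4 : ℝ) * ∑ B, (fundamentalMatrix (F x) y)⁻¹ A B *
    ((∑ C, pd C (fun x' => pd B (fun w => F x' w ^ 2) y) x * y C)
      - pd B (fun x' => F x' y ^ 2) x)

/-- The Berwald curvature `B^A_{BCD} = ∂³G^A/∂y^B∂y^C∂y^D`. -/
def berwald {n : ℕ} (F : Coord n → Coord n → ℝ) (A B C D : Fin (n + 1)) (x y : Coord n) : ℝ :=
  pd B (pd C (pd D (spray F A x))) y

/-- The Landsberg curvature `L_{ABC} = -¼ (∂(F²)/∂y^D) (∂³G^D/∂y^A∂y^B∂y^C)`. -/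
def landsberg {n : ℕ} (F : Coord n → Coord n → ℝ) (A B C : Fin (n + 1)) (x y : Coord n) : ℝ :=
  -(1 / 4 : ℝ) * ∑ D, pd D (fun w => F x w ^ 2) y * pd A (pd B (pd C (spray F D x))) y

/-- `F` is a Berwald metric on `M`: the Berwald curvature vanishes on the slit tangent bundle. -/
def IsBerwald {n : ℕ} (M : Set (Coord n)) (F : Coord n → Coord n → ℝ) : Prop :=
  ∀ x ∈ M, ∀ y, y ≠ 0 → ∀ A B C D, berwald F A B C D x y = 0

/-- `F` is a Landsberg metric on `M`: the Landsberg curvature vanishes on the slit tangent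
bundle. -/
def IsLandsberg {n : ℕ} (M : Set (Coord n)) (F : Coord n → Coord n → ℝ) : Prop :=
  ∀ x ∈ M, ∀ y, y ≠ 0 → ∀ A B C, landsberg F A B C x y = 0

end Finsler

end

open scoped ContDiff Topology

namespace Finsler

variable {n : ℕ}

/-! Only "Landsberg implies Berwald" needs an argument. Fix `x⁰ = t` and `|x̄| = r > 0`, put `ψ =
φ(t, r, ·)²`, and let `μ`, `ν` be the `t`- and `r`-derivatives of `φ²`. Where `ȳ ≠ 0`, `F² = |ȳ|²
ψ(z)`, and rotational symmetry forces, with `w = ⟨x̄, ȳ⟩ / r`, `G⁰ = |ȳ|² α(z) + w |ȳ| γ(z)` and `Gʲ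
= yʲ |ȳ| β(z) + yʲ w δ(z) + (xʲ/r) |ȳ|² ε(z)`. The five profiles solve a linear system in `ψ`, `μ`,
`ν` (`exists_spray_profiles`, `IsCylindrical.spray_eq`).

The Landsberg condition is tested at `y = (z, eᵢ)` with `x̄ = ±r eᵢ` and `x̄ = r eⱼ`, `j ≠ i`. The
sign change separates equations for `α`, `β` from equations for `γ`, `δ`, `ε`. In each group two
equations become a homogeneous linear system, nonsingular wherever `q = ψ' - zψ''` is nonzero. On
open sets where `q = 0`, `ψ` is locally quadratic, the spray system decouples, and the Landsberg
equations restrict `μ` and `ν` enough to give the same conclusion. By density, `α` and `ε` have the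
form `kz² + c`, `β = lz + m`, `γ = kz`, and `δ` is constant (`landsberg_ode_symmetric`,
`landsberg_ode_axial`).

The spray is then quadratic in `y` up to the term `m yʲ |ȳ|`. Regularity of `F` across `ȳ = 0`
excludes that term (`eq_zero_of_smooth_mul_abs`), so the Berwald curvature vanishes where `x̄, ȳ ≠
0`, and by continuity everywhere. -/

theorem isOpen_spatial_ne : IsOpen {y : Coord n | spatial y ≠ 0} := by
  have h : Continuous (spatial (n := n)) := by
    unfold spatial
    fun_prop
  exact isOpen_ne_fun h continuous_const

theorem norm_spatial_sq (y : Coord n) : ‖spatial y‖ ^ 2 = ∑ i : Fin n, y i.succ ^ 2 := by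
  rw [EuclideanSpace.norm_sq_eq]
  simp [spatial]

theorem norm_spatial_pos {y : Coord n} (hy : spatial y ≠ 0) : 0 < ‖spatial y‖ :=
  norm_pos_iff.2 hy

theorem contDiff_spatial : ContDiff ℝ ∞ (spatial (n := n)) := by
  unfold spatial
  fun_prop

theorem differentiableAt_norm_spatial {y : Coord n} (hy : spatial y ≠ 0) :
    DifferentiableAt ℝ (fun w : Coord n => ‖spatial w‖) y :=
  (contDiff_spatial.differentiable (by simp) y).norm ℝ hy

/-! ### Partial derivatives away from `ȳ = 0` -/

theorem differentiable_coord (A : Fin (n + 1)) : Differentiable ℝ (fun w : Coord n => w A) := by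
  fun_prop

theorem pd_coord (A B : Fin (n + 1)) (y : Coord n) :
    pd A (fun w : Coord n => w B) y = if A = B then 1 else 0 := by
  have : HasFDerivAt (fun w : Coord n => w B)
    (ContinuousLinearMap.proj (R := ℝ) (φ := fun _ : Fin (n + 1) => ℝ) B) y :=
    (ContinuousLinearMap.proj (R := ℝ) (φ := fun _ : Fin (n + 1) => ℝ) B).hasFDerivAt
  simp [pd, this.fderiv, Pi.single_apply, eq_comm]

theorem pd_add (A : Fin (n + 1)) {f g : Coord n → ℝ} {y : Coord n} (hf : DifferentiableAt ℝ f y)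
    (hg : DifferentiableAt ℝ g y) : pd A (fun w => f w + g w) y = pd A f y + pd A g y := by
  simp [pd, fderiv_fun_add hf hg]

theorem pd_mul (A : Fin (n + 1)) {f g : Coord n → ℝ} {y : Coord n} (hf : DifferentiableAt ℝ f y)
    (hg : DifferentiableAt ℝ g y) :
    pd A (fun w => f w * g w) y = f y * pd A g y + g y * pd A f y := by
  simp [pd, fderiv_fun_mul hf hg]

theorem pd_const (A : Fin (n + 1)) (c : ℝ) (y : Coord n) : pd A (fun _ => c) y = 0 := by
  simp [pd]

theorem pd_sum {ι : Type*} (s : Finset ι) (A : Fin (n + 1)) {f : ι → Coord n → ℝ} {y : Coord n}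
    (hf : ∀ i ∈ s, DifferentiableAt ℝ (f i) y) :
    pd A (fun w => ∑ i ∈ s, f i w) y = ∑ i ∈ s, pd A (f i) y := by
  simp [pd, fderiv_fun_sum hf]

theorem pd_comp (A : Fin (n + 1)) {h : ℝ → ℝ} {g : Coord n → ℝ} {y : Coord n}
    (hh : DifferentiableAt ℝ h (g y)) (hg : DifferentiableAt ℝ g y) :
    pd A (fun w => h (g w)) y = deriv h (g y) * pd A g y := by
  have := hh.hasDerivAt.comp_hasFDerivAt y hg.hasFDerivAt
  have h2 : fderiv ℝ (fun w => h (g w)) y = _ := this.fderiv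
  simp [pd, h2]

theorem pd_congr (A : Fin (n + 1)) {f g : Coord n → ℝ} {y : Coord n}
    (h : f =ᶠ[𝓝 y] g) : pd A f y = pd A g y := by
  simp [pd, h.fderiv_eq]

theorem pd_norm_spatial_sq (A : Fin (n + 1)) (y : Coord n) :
    pd A (fun w : Coord n => ‖spatial w‖ ^ 2) y = 2 * Fin.cons (α := fun _ => ℝ) 0 (fun i => y i.succ) A := by
  have h : (fun w : Coord n => ‖spatial w‖ ^ 2) = fun w => ∑ i : Fin n, w i.succ * w i.succ := by
    funext w
    simp only [norm_spatial_sq, ← pow_two]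
  rw [h, pd_sum _ _ (fun i _ => by fun_prop)]
  have h2 : ∀ i : Fin n, pd A (fun w : Coord n => w i.succ * w i.succ) y
      = 2 * (if A = i.succ then y i.succ else 0) := by
    intro i
    rw [pd_mul A (by fun_prop) (by fun_prop), pd_coord]
    split_ifs <;> ring
  simp_rw [h2, ← Finset.mul_sum]
  refine Fin.cases ?_ (fun j => ?_) A
  · simp [(Fin.succ_ne_zero _).symm]
  · simp [Fin.succ_inj]

theorem pd_norm_spatial (A : Fin (n + 1)) {y : Coord n} (hy : spatial y ≠ 0) :
    pd A (fun w : Coord n => ‖spatial w‖) y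
      = Fin.cons (α := fun _ => ℝ) 0 (fun i => y i.succ) A / ‖spatial y‖ := by
  have hd := differentiableAt_norm_spatial hy
  have h1 := pd_norm_spatial_sq A y
  simp_rw [pow_two] at h1
  rw [pd_mul A hd hd] at h1
  have := norm_spatial_pos hy
  field_simp
  linarith

/-- The function `|ȳ|^k h(y⁰/|ȳ|)`. -/
noncomputable def radial (k : ℤ) (h : ℝ → ℝ) (y : Coord n) : ℝ := ‖spatial y‖ ^ k * h (y 0 / ‖spatial y‖)

/-- `f` is differentiable with `∂f/∂v^A = g` at all vectors with nonzero spatial part. -/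
def HasPd (A : Fin (n + 1)) (f g : Coord n → ℝ) : Prop :=
  ∀ y, spatial y ≠ 0 → DifferentiableAt ℝ f y ∧ pd A f y = g y

theorem HasPd.add {A : Fin (n + 1)} {f g f' g' : Coord n → ℝ} (hf : HasPd A f f')
    (hg : HasPd A g g') : HasPd A (fun y => f y + g y) (fun y => f' y + g' y) := fun y hy =>
  ⟨(hf y hy).1.add (hg y hy).1, by
    rw [pd_add A (hf y hy).1 (hg y hy).1, (hf y hy).2, (hg y hy).2]⟩

theorem HasPd.mul {A : Fin (n + 1)} {f g f' g' : Coord n → ℝ} (hf : HasPd A f f')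
    (hg : HasPd A g g') : HasPd A (fun y => f y * g y) (fun y => f y * g' y + g y * f' y) :=
  fun y hy => ⟨(hf y hy).1.mul (hg y hy).1, by
    rw [pd_mul A (hf y hy).1 (hg y hy).1, (hf y hy).2, (hg y hy).2]⟩

theorem hasPd_const (A : Fin (n + 1)) (c : ℝ) : HasPd A (fun _ : Coord n => c) (fun _ => 0) :=
  fun y _ => ⟨by fun_prop, pd_const A c y⟩

theorem hasPd_coord (A B : Fin (n + 1)) :
    HasPd A (fun y : Coord n => y B) (fun _ => if A = B then 1 else 0) :=
  fun y _ => ⟨by fun_prop, pd_coord A B y⟩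

theorem HasPd.congr {A : Fin (n + 1)} {f g f' g' : Coord n → ℝ} (h : HasPd A f f')
    (hf : ∀ y, spatial y ≠ 0 → g y = f y) (hf' : ∀ y, spatial y ≠ 0 → g' y = f' y) :
    HasPd A g g' := fun y hy => by
  have he : g =ᶠ[𝓝 y] f := by
    filter_upwards [isOpen_spatial_ne.mem_nhds hy] with w hw using hf w hw
  exact ⟨(h y hy).1.congr_of_eventuallyEq he, by
    rw [pd_congr A he, (h y hy).2, hf' y hy]⟩

theorem HasPd.pd {A B : Fin (n + 1)} {f f' g : Coord n → ℝ} (h : HasPd A f f')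
    (h' : HasPd B f' g) : HasPd B (Finsler.pd A f) g :=
  h'.congr (fun y hy => (h y hy).2) (fun _ _ => rfl)

theorem differentiableAt_ratio {y : Coord n} (hy : spatial y ≠ 0) :
    DifferentiableAt ℝ (fun w : Coord n => w 0 / ‖spatial w‖) y :=
  (differentiable_coord 0 y).fun_mul
    ((differentiableAt_norm_spatial hy).fun_inv (norm_spatial_pos hy).ne')

theorem pd_ratio (A : Fin (n + 1)) {y : Coord n} (hy : spatial y ≠ 0) :
    pd A (fun w : Coord n => w 0 / ‖spatial w‖) y
      = (if A = 0 then 1 else 0) / ‖spatial y‖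
        - y 0 / ‖spatial y‖ * Fin.cons (α := fun _ => ℝ) 0 (fun i => y i.succ) A
          / ‖spatial y‖ ^ 2 := by
  have h0 := norm_spatial_pos hy
  have h1 : pd A (fun w : Coord n => w 0) y
      = pd A (fun w => w 0 / ‖spatial w‖ * ‖spatial w‖) y := by
    refine pd_congr A ?_
    filter_upwards [isOpen_spatial_ne.mem_nhds hy] with w hw
    have := (norm_spatial_pos hw).ne'
    field_simp
  rw [pd_coord, pd_mul A (differentiableAt_ratio hy) (differentiableAt_norm_spatial hy),
    pd_norm_spatial A hy] at h1
  rw [h1]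
  field_simp
  ring

/-- Up to coordinate factors, radial functions are closed under differentiation: `∂₀` lowers the
degree by one, and `∂ᵢ` pulls out `yⁱ` and lowers it by two. All later derivatives reduce to this
rule. -/
theorem hasPd_radial (A : Fin (n + 1)) (k : ℤ) {h : ℝ → ℝ} (hh : Differentiable ℝ h) :
    HasPd A (radial (n := n) k h) (fun y =>
      (if A = 0 then 1 else 0) * radial (k - 1) (deriv h) y
      + Fin.cons (α := fun _ => ℝ) 0 (fun i => y i.succ) A
        * radial (k - 2) (fun z => k * h z - z * deriv h z) y) := fun y hy => by
  have h0 := norm_spatial_pos hy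
  have hd : DifferentiableAt ℝ (fun w : Coord n => h (w 0 / ‖spatial w‖)) y :=
    (hh _).comp y (differentiableAt_ratio hy)
  have hk : DifferentiableAt ℝ (fun v : ℝ => v ^ k) ‖spatial y‖ :=
    differentiableAt_zpow.2 (Or.inl h0.ne')
  have hv : DifferentiableAt ℝ (fun w : Coord n => ‖spatial w‖ ^ k) y :=
    hk.fun_comp' y (differentiableAt_norm_spatial hy)
  refine ⟨hv.mul hd, ?_⟩
  have e1 := pd_mul A hv hd
  rw [pd_comp A (hh _) (differentiableAt_ratio hy), pd_ratio A hy,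
    pd_comp A hk (differentiableAt_norm_spatial hy), deriv_zpow, pd_norm_spatial A hy] at e1
  refine Eq.trans e1 ?_
  simp only [radial]
  rw [zpow_sub_one₀ h0.ne', zpow_sub₀ h0.ne', zpow_ofNat]
  field_simp
  ring

theorem hasPd_zero_radial (k : ℤ) {h : ℝ → ℝ} (hh : Differentiable ℝ h) :
    HasPd (n := n) 0 (radial k h) (radial (k - 1) (deriv h)) :=
  (hasPd_radial 0 k hh).congr (fun _ _ => rfl) (fun y _ => by simp)

theorem hasPd_succ_radial (i : Fin n) (k : ℤ) {h : ℝ → ℝ} (hh : Differentiable ℝ h) :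
    HasPd i.succ (radial k h)
      (fun y => y i.succ * radial (k - 2) (fun z => k * h z - z * deriv h z) y) :=
  (hasPd_radial i.succ k hh).congr (fun _ _ => rfl) (fun y _ => by simp [Fin.succ_ne_zero])

/-! ### Partial derivatives of functions on a product -/

theorem pd_snd {f : Coord n × Coord n → ℝ} {x y : Coord n} (A : Fin (n + 1))
    (hf : DifferentiableAt ℝ f (x, y)) :
    pd A (fun w => f (x, w)) y = fderiv ℝ f (x, y) (0, Pi.single A 1) := by
  have h : HasFDerivAt (fun w => f (x, w)) _ y :=
    HasFDerivAt.comp y hf.hasFDerivAt (hasFDerivAt_prodMk_right x y)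
  simp [pd, h.fderiv]

theorem pd_fst {f : Coord n × Coord n → ℝ} {x y : Coord n} (A : Fin (n + 1))
    (hf : DifferentiableAt ℝ f (x, y)) :
    pd A (fun w => f (w, y)) x = fderiv ℝ f (x, y) (Pi.single A 1, 0) := by
  have h : HasFDerivAt (fun w => f (w, y)) _ x :=
    HasFDerivAt.comp x hf.hasFDerivAt (hasFDerivAt_prodMk_left x y)
  simp [pd, h.fderiv]

theorem contDiffOn_pd_snd {f : Coord n × Coord n → ℝ} {U : Set (Coord n × Coord n)}
    (hU : IsOpen U) (A : Fin (n + 1)) (hf : ContDiffOn ℝ ∞ f U) :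
    ContDiffOn ℝ ∞ (fun p => pd A (fun w => f (p.1, w)) p.2) U := by
  have h : ContDiffOn ℝ ∞ (fun p => fderiv ℝ f p (0, Pi.single A 1)) U :=
    (hf.fderiv_of_isOpen hU (by simp)).clm_apply contDiffOn_const
  exact h.congr fun p hp => pd_snd A
    ((hf.contDiffAt (hU.mem_nhds hp)).differentiableAt (by simp))

theorem contDiffOn_pd_fst {f : Coord n × Coord n → ℝ} {U : Set (Coord n × Coord n)}
    (hU : IsOpen U) (A : Fin (n + 1)) (hf : ContDiffOn ℝ ∞ f U) :
    ContDiffOn ℝ ∞ (fun p => pd A (fun w => f (w, p.2)) p.1) U := by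
  have h : ContDiffOn ℝ ∞ (fun p => fderiv ℝ f p (Pi.single A 1, 0)) U :=
    (hf.fderiv_of_isOpen hU (by simp)).clm_apply contDiffOn_const
  exact h.congr fun p hp => pd_fst A
    ((hf.contDiffAt (hU.mem_nhds hp)).differentiableAt (by simp))

/-- Lets the mixed term of the spray be computed as a `y`-derivative of `∂(F²)/∂x`, which is itself
radial in `y`. -/
theorem pd_fst_pd_snd_comm {f : Coord n × Coord n → ℝ} {U : Set (Coord n × Coord n)}
    (hU : IsOpen U) (hf : ContDiffOn ℝ ∞ f U) {x y : Coord n} (hp : (x, y) ∈ U)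
    (A B : Fin (n + 1)) :
    pd A (fun x' => pd B (fun w => f (x', w)) y) x
      = pd B (fun w => pd A (fun x' => f (x', w)) x) y := by
  have hd : ∀ p ∈ U, DifferentiableAt ℝ f p := fun p hp =>
    (hf.contDiffAt (hU.mem_nhds hp)).differentiableAt (by simp)
  have hd2 : DifferentiableAt ℝ (fderiv ℝ f) (x, y) :=
    ((hf.fderiv_of_isOpen (m := ∞) hU (by simp)).contDiffAt (hU.mem_nhds hp)).differentiableAt
      (by simp)
  have e1 : (fun x' => pd B (fun w => f (x', w)) y)
      =ᶠ[𝓝 x] fun x' => fderiv ℝ f (x', y) (0, Pi.single B 1) := by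
    have : ∀ᶠ x' in 𝓝 x, (x', y) ∈ U :=
      (by fun_prop : Continuous fun x' : Coord n => (x', y)).continuousAt.eventually
        (hU.mem_nhds hp)
    filter_upwards [this] with x' hx' using pd_snd B (hd _ hx')
  have e2 : (fun w => pd A (fun x' => f (x', w)) x)
      =ᶠ[𝓝 y] fun w => fderiv ℝ f (x, w) (Pi.single A 1, 0) := by
    have : ∀ᶠ w in 𝓝 y, (x, w) ∈ U :=
      (by fun_prop : Continuous fun w : Coord n => (x, w)).continuousAt.eventually
        (hU.mem_nhds hp)
    filter_upwards [this] with w hw using pd_fst A (hd _ hw)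
  rw [pd_congr A e1, pd_congr B e2,
    pd_fst (f := fun p => fderiv ℝ f p (0, Pi.single B 1)) A
      (hd2.clm_apply (differentiableAt_const _)),
    pd_snd (f := fun p => fderiv ℝ f p (Pi.single A 1, 0)) B
      (hd2.clm_apply (differentiableAt_const _)),
    fderiv_clm_apply hd2 (differentiableAt_const _), fderiv_clm_apply hd2 (differentiableAt_const _)]
  have hs : IsSymmSndFDerivAt ℝ f (x, y) :=
    (hf.contDiffAt (hU.mem_nhds hp)).isSymmSndFDerivAt (by
      rw [minSmoothness_of_isRCLikeNormedField]
      exact WithTop.coe_le_coe.2 le_top)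
  simpa using hs.eq _ _

/-! ### The ordinary differential equations for the profiles -/

theorem deriv_congr_on {U : Set ℝ} (hU : IsOpen U) {f g f' g' : ℝ → ℝ}
    (h : ∀ z ∈ U, f z = g z) (hf : ∀ z, HasDerivAt f (f' z) z) (hg : ∀ z, HasDerivAt g (g' z) z) :
    ∀ z ∈ U, f' z = g' z := fun z hz => by
  have he : f =ᶠ[𝓝 z] g := by filter_upwards [hU.mem_nhds hz] with w hw using h w hw
  exact (hf z).unique ((hg z).congr_of_eventuallyEq he)

/-- Where `X ≠ 0` and `z ≠ 0`, the first hypothesis forces `q = 0`. That set is open, so the second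
hypothesis makes it empty; continuity then covers `z = 0`. -/
theorem eq_zero_of_dense_cases {q X : ℝ → ℝ} (hX : Continuous X)
    (h1 : ∀ z, q z ≠ 0 → X z = 0)
    (h2 : ∀ U : Set ℝ, IsOpen U → (∀ z ∈ U, z ≠ 0) → (∀ z ∈ U, q z = 0) → ∀ z ∈ U, X z = 0) :
    ∀ z, X z = 0 := by
  have hne : ∀ z, z ≠ 0 → X z = 0 := by
    intro z hz
    by_contra hXz
    have hU : IsOpen ({w : ℝ | w ≠ 0} ∩ {w | X w ≠ 0}) :=
      isOpen_ne.inter (isOpen_ne_fun hX continuous_const)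
    refine hXz (h2 _ hU (fun w hw => hw.1) (fun w hw => ?_) z ⟨hz, hXz⟩)
    by_contra hqw
    exact hw.2 (h1 w hqw)
  have hd : Dense {z : ℝ | z ≠ 0} := dense_compl_singleton 0
  exact fun z => congrFun (Continuous.ext_on hd hX continuous_const fun w hw => hne w hw) z

theorem eq_zero_of_mul_eq_zero {f : ℝ → ℝ} (hf : Continuous f) (h : ∀ z, z * f z = 0) :
    ∀ z, f z = 0 := by
  have hd : Dense {z : ℝ | z ≠ 0} := dense_compl_singleton 0
  exact fun z => congrFun (Continuous.ext_on hd hf continuous_const fun w hw =>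
    (mul_eq_zero.1 (h w)).resolve_left hw) z

theorem eq_const_of_deriv {f : ℝ → ℝ} (h : ∀ z, HasDerivAt f 0 z) (z : ℝ) : f z = f 0 :=
  is_const_of_deriv_eq_zero (fun z => (h z).differentiableAt) (fun z => (h z).deriv) z 0

theorem contDiff_hasDerivAt {f : ℝ → ℝ} (hf : ContDiff ℝ ∞ f) :
    ContDiff ℝ ∞ (deriv f) ∧ ∀ z, HasDerivAt f (deriv f z) z :=
  ⟨(contDiff_infty_iff_deriv.1 hf).2, fun z => ((contDiff_infty_iff_deriv.1 hf).1 z).hasDerivAt⟩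

/-- Subtracting the equations gives `q (X + zY) = 0` with `q = ψ₁ - zψ₂`; inserting `X = -zY` into
the first leaves `2ψY = 0`. -/
theorem radial_alternative {z ψ ψ₁ ψ₂ X Y : ℝ} (hψ : 0 < ψ) (hq : ψ₁ - z * ψ₂ ≠ 0)
    (h1 : ψ₁ * X = (2 * ψ - z * ψ₁) * Y)
    (h2 : z * ψ₂ * X = z * (ψ₁ - z * ψ₂) * Y + (2 * ψ - z * ψ₁) * Y) : X = 0 ∧ Y = 0 := by
  have h3 : (ψ₁ - z * ψ₂) * (X + z * Y) = 0 := by linear_combination h1 - h2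
  have h4 : X = -(z * Y) := by linarith [(mul_eq_zero.1 h3).resolve_left hq]
  have h5 : ψ * Y = 0 := by rw [h4] at h1; linarith
  have h6 := (mul_eq_zero.1 h5).resolve_left hψ.ne'
  exact ⟨by rw [h4, h6]; simp, h6⟩

/-- Differentiating once more gives `zα''' = 0`, so `α''` is constant and `α' = zα''` is linear. -/
theorem quadratic_of_odd_deriv {α : ℝ → ℝ} (hα : ContDiff ℝ ∞ α)
    (h : ∀ z, deriv α z - z * deriv (deriv α) z = 0) : ∃ k c : ℝ, ∀ z, α z = k * z ^ 2 + c := by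
  obtain ⟨hα1, dα⟩ := contDiff_hasDerivAt hα
  obtain ⟨hα2, dα1⟩ := contDiff_hasDerivAt hα1
  obtain ⟨hα3, dα2⟩ := contDiff_hasDerivAt hα2
  have h3 : ∀ z, deriv (deriv (deriv α)) z = 0 := by
    refine eq_zero_of_mul_eq_zero hα3.continuous fun z => ?_
    have := deriv_congr_on isOpen_univ (f := fun z => deriv α z - z * deriv (deriv α) z)
      (g := fun _ => 0) (fun z _ => h z)
      (fun z => (dα1 z).sub ((hasDerivAt_id z).mul (dα2 z))) (fun z => hasDerivAt_const z _)
      z trivial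
    rcases (by simpa using this : z = 0 ∨ deriv (deriv (deriv α)) z = 0) with h | h <;> simp [h]
  have h2 : ∀ z, deriv (deriv α) z = deriv (deriv α) 0 :=
    eq_const_of_deriv fun z => by simpa [h3 z] using dα2 z
  set k := deriv (deriv α) 0
  refine ⟨k / 2, α 0, fun z => ?_⟩
  have := eq_const_of_deriv (f := fun z => α z - k / 2 * z ^ 2) (fun z => by
    have h5 := (dα z).fun_sub (((hasDerivAt_id' z).fun_pow 2).const_mul (k / 2))
    refine h5.congr_deriv ?_
    have := h z
    rw [h2] at this
    push_cast
    linarith) z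
  simp at this
  linarith

theorem affine_of_deriv_deriv {β : ℝ → ℝ} (hβ : ContDiff ℝ ∞ β)
    (h : ∀ z, deriv (deriv β) z = 0) : ∃ l m : ℝ, ∀ z, β z = l * z + m := by
  obtain ⟨hβ1, dβ⟩ := contDiff_hasDerivAt hβ
  obtain ⟨hβ2, dβ1⟩ := contDiff_hasDerivAt hβ1
  have h2 : ∀ z, deriv β z = deriv β 0 :=
    eq_const_of_deriv fun z => by simpa [h z] using dβ1 z
  refine ⟨deriv β 0, β 0, fun z => ?_⟩
  have := eq_const_of_deriv (f := fun z => β z - deriv β 0 * z) (fun z => by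
    have h5 := (dβ z).fun_sub ((hasDerivAt_id' z).const_mul (deriv β 0))
    refine h5.congr_deriv ?_
    rw [h2 z]
    ring) z
  simp at this
  linarith

section
variable {ψ μ ν α β γ δ ε : ℝ → ℝ}

/-- The unknowns are `X = α' - zα''` and `Y = zβ''`, both to be shown zero. `L2` is one linear
relation between them; its derivative, cleared of third derivatives by `L1`, is another. Where they
degenerate, the spray equations `S1`, `S2` take over. -/
theorem landsberg_ode_symmetric (cψ : ContDiff ℝ ∞ ψ) (cμ : ContDiff ℝ ∞ μ)
    (cα : ContDiff ℝ ∞ α) (cβ : ContDiff ℝ ∞ β)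
    (pψ : ∀ z, 0 < ψ z) (pe : ∀ z, 0 < 2 * ψ z - z * deriv ψ z)
    (pψ2 : ∀ z, 0 < deriv (deriv ψ) z)
    (S1 : ∀ z, deriv (deriv ψ) z * α z + (deriv ψ z - z * deriv (deriv ψ) z) * β z
      = 1 / 2 * (z * deriv μ z - μ z))
    (S2 : ∀ z, (deriv ψ z - z * deriv (deriv ψ) z) * α z
      + (2 * ψ z - z * deriv ψ z - z * (deriv ψ z - z * deriv (deriv ψ) z)) * β z
      = 1 / 2 * (z * (2 * μ z - z * deriv μ z)))
    (L1 : ∀ z, deriv ψ z * deriv (deriv (deriv α)) z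
      + (2 * ψ z - z * deriv ψ z) * deriv (deriv (deriv β)) z = 0)
    (L2 : ∀ z, deriv ψ z * (deriv α z - z * deriv (deriv α) z)
      - (2 * ψ z - z * deriv ψ z) * (z * deriv (deriv β) z) = 0) :
    (∃ k c : ℝ, ∀ z, α z = k * z ^ 2 + c) ∧ ∃ l m : ℝ, ∀ z, β z = l * z + m := by
  obtain ⟨cψ1, dψ⟩ := contDiff_hasDerivAt cψ
  obtain ⟨cψ2, dψ1⟩ := contDiff_hasDerivAt cψ1
  obtain ⟨cψ3, dψ2⟩ := contDiff_hasDerivAt cψ2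
  obtain ⟨cμ1, dμ⟩ := contDiff_hasDerivAt cμ
  obtain ⟨cμ2, dμ1⟩ := contDiff_hasDerivAt cμ1
  obtain ⟨cμ3, dμ2⟩ := contDiff_hasDerivAt cμ2
  obtain ⟨cα1, dα⟩ := contDiff_hasDerivAt cα
  obtain ⟨cα2, dα1⟩ := contDiff_hasDerivAt cα1
  obtain ⟨cα3, dα2⟩ := contDiff_hasDerivAt cα2
  obtain ⟨cβ1, dβ⟩ := contDiff_hasDerivAt cβ
  obtain ⟨cβ2, dβ1⟩ := contDiff_hasDerivAt cβ1
  obtain ⟨cβ3, dβ2⟩ := contDiff_hasDerivAt cβ2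
  set ψ1 := deriv ψ
  set ψ2 := deriv ψ1
  set ψ3 := deriv ψ2
  set μ1 := deriv μ
  set μ2 := deriv μ1
  set μ3 := deriv μ2
  set α1 := deriv α
  set α2 := deriv α1
  set α3 := deriv α2
  set β1 := deriv β
  set β2 := deriv β1
  set β3 := deriv β2
  have kψ := cψ.continuous
  have kψ1 := cψ1.continuous
  have kψ2 := cψ2.continuous
  have kα1 := cα1.continuous
  have kα2 := cα2.continuous
  have kβ2 := cβ2.continuous
  have did := fun z : ℝ => hasDerivAt_id' z
  have hneq : ∀ z, ψ1 z - z * ψ2 z ≠ 0 → α1 z - z * α2 z = 0 ∧ z * β2 z = 0 := by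
    intro z hq
    refine radial_alternative (pψ z) hq (by linarith [L2 z]) ?_
    have := deriv_congr_on isOpen_univ (fun z _ => L2 z)
      (fun z => ((dψ1 z).fun_mul ((dα1 z).fun_sub ((did z).fun_mul (dα2 z)))).fun_sub
        ((((dψ z).const_mul 2).fun_sub ((did z).fun_mul (dψ1 z))).fun_mul
          ((did z).fun_mul (dβ2 z)))) (fun z => hasDerivAt_const z _) z trivial
    linear_combination z * this + z ^ 2 * L1 z
  have heq : ∀ U : Set ℝ, IsOpen U → (∀ z ∈ U, z ≠ 0) → (∀ z ∈ U, ψ1 z - z * ψ2 z = 0) →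
      ∀ z ∈ U, α1 z - z * α2 z = 0 ∧ z * β2 z = 0 := by
    intro U hU h0 hq
    -- The derivative of `ψ' - zψ''` is `-zψ'''`. Hence `ψ''` is locally constant, and so is `2ψ -
    -- zψ'`, whose derivative is `ψ' - zψ''`; the decoupled spray equations can be differentiated
    -- freely.
    have hψ3 : ∀ z ∈ U, ψ3 z = 0 := by
      intro z hz
      have := deriv_congr_on hU hq (fun z => (dψ1 z).fun_sub ((did z).fun_mul (dψ2 z)))
        (fun z => hasDerivAt_const z _) z hz
      have h3 : z * ψ3 z = 0 := by linarith
      exact (mul_eq_zero.1 h3).resolve_left (h0 z hz)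
    have a0 : ∀ z ∈ U, ψ2 z * α z = 1 / 2 * (z * μ1 z - μ z) := fun z hz => by
      have := S1 z
      rw [hq z hz] at this
      linarith
    have a1 : ∀ z ∈ U, ψ2 z * α1 z = 1 / 2 * (z * μ2 z) := fun z hz => by
      have := deriv_congr_on hU a0 (fun z => (dψ2 z).fun_mul (dα z))
        (fun z => (((did z).fun_mul (dμ1 z)).fun_sub (dμ z)).const_mul _) z hz
      rw [hψ3 z hz] at this
      linarith
    have a2 : ∀ z ∈ U, ψ2 z * α2 z = 1 / 2 * (μ2 z + z * μ3 z) := fun z hz => by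
      have := deriv_congr_on hU a1 (fun z => (dψ2 z).fun_mul (dα1 z))
        (fun z => ((did z).fun_mul (dμ2 z)).const_mul _) z hz
      rw [hψ3 z hz] at this
      linarith
    have b0 : ∀ z ∈ U, (2 * ψ z - z * ψ1 z) * β z = 1 / 2 * (z * (2 * μ z - z * μ1 z)) :=
      fun z hz => by
        have := S2 z
        rw [hq z hz] at this
        linarith
    have b1 : ∀ z ∈ U, (2 * ψ z - z * ψ1 z) * β1 z = 1 / 2 * (2 * μ z - z * (z * μ2 z)) :=
      fun z hz => by
        have := deriv_congr_on hU b0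
          (fun z => (((dψ z).const_mul 2).fun_sub ((did z).fun_mul (dψ1 z))).fun_mul (dβ z))
          (fun z => ((did z).fun_mul (((dμ z).const_mul 2).fun_sub
            ((did z).fun_mul (dμ1 z)))).const_mul _) z hz
        linear_combination this - β z * hq z hz
    have b2 : ∀ z ∈ U, (2 * ψ z - z * ψ1 z) * β2 z
        = 1 / 2 * (2 * μ1 z - 2 * z * μ2 z - z ^ 2 * μ3 z) := fun z hz => by
      have := deriv_congr_on hU b1
        (fun z => (((dψ z).const_mul 2).fun_sub ((did z).fun_mul (dψ1 z))).fun_mul (dβ1 z))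
        (fun z => (((dμ z).const_mul 2).fun_sub
          ((did z).fun_mul ((did z).fun_mul (dμ2 z)))).const_mul _) z hz
      linear_combination this - β1 z * hq z hz
    -- With `ψ' = zψ''`, substituting the decoupled equations turns `L2` into `-z (μ' - zμ'') = 0`.
    have m1 : ∀ z ∈ U, μ1 z - z * μ2 z = 0 := fun z hz => by
      have h1 : z * (μ1 z - z * μ2 z) = 0 := by
        linear_combination -z * b2 z hz - L2 z + (α1 z - z * α2 z) * hq z hz + z * a1 z hz
          - z ^ 2 * a2 z hz
      exact (mul_eq_zero.1 h1).resolve_left (h0 z hz)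
    intro z hz
    have m2 := deriv_congr_on hU m1 (fun z => (dμ1 z).fun_sub ((did z).fun_mul (dμ2 z)))
      (fun z => hasDerivAt_const z _) z hz
    have hX : ψ2 z * (α1 z - z * α2 z) = 0 := by
      linear_combination a1 z hz - z * a2 z hz + 1 / 2 * z * m2
    have hY : (2 * ψ z - z * ψ1 z) * (z * β2 z) = 0 := by
      linear_combination z * b2 z hz + z * m1 z hz + 1 / 2 * z ^ 2 * m2
    exact ⟨(mul_eq_zero.1 hX).resolve_left (pψ2 z).ne', (mul_eq_zero.1 hY).resolve_left (pe z).ne'⟩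
  constructor
  · refine quadratic_of_odd_deriv cα (eq_zero_of_dense_cases (q := fun z => ψ1 z - z * ψ2 z)
      (kα1.sub (continuous_id.mul kα2)) (fun z hz => (hneq z hz).1)
      (fun U hU h0 hq z hz => (heq U hU h0 hq z hz).1))
  · refine affine_of_deriv_deriv cβ (eq_zero_of_mul_eq_zero kβ2 (eq_zero_of_dense_cases
      (q := fun z => ψ1 z - z * ψ2 z)
      (continuous_id.mul kβ2) (fun z hz => (hneq z hz).2)
      (fun U hU h0 hq z hz => (heq U hU h0 hq z hz).2)))

/-- Same scheme with `X = γ - zγ'`, `Y = zδ'` and `B1`, `B2` as the two relations. Once `γ` and `δ`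
are known, `A2` reduces to `(2ψ - zψ') (ε' - zε'') = 0`. -/
theorem landsberg_ode_axial (cψ : ContDiff ℝ ∞ ψ) (cν : ContDiff ℝ ∞ ν)
    (cγ : ContDiff ℝ ∞ γ) (cδ : ContDiff ℝ ∞ δ) (cε : ContDiff ℝ ∞ ε)
    (pψ : ∀ z, 0 < ψ z) (pe : ∀ z, 0 < 2 * ψ z - z * deriv ψ z)
    (pψ2 : ∀ z, 0 < deriv (deriv ψ) z)
    (S3 : ∀ z, deriv (deriv ψ) z * γ z + (deriv ψ z - z * deriv (deriv ψ) z) * (δ z + ε z)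
      = 1 / 2 * deriv ν z)
    (S4 : ∀ z, (deriv ψ z - z * deriv (deriv ψ) z) * γ z
      + (2 * ψ z - z * deriv ψ z - z * (deriv ψ z - z * deriv (deriv ψ) z)) * (δ z + ε z)
      = 1 / 2 * (ν z - z * deriv ν z))
    (S5 : ∀ z, (2 * ψ z - z * deriv ψ z) * ε z = -(1 / 2) * ν z)
    (A2 : ∀ z, deriv ψ z * (-(z * deriv (deriv γ) z)) + (2 * ψ z - z * deriv ψ z) *
      (-deriv δ z - z * deriv (deriv δ) z + (deriv ε z - z * deriv (deriv ε) z)) = 0)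
    (B1 : ∀ z, deriv ψ z * deriv (deriv γ) z
      + (2 * ψ z - z * deriv ψ z) * deriv (deriv δ) z = 0)
    (B2 : ∀ z, deriv ψ z * (γ z - z * deriv γ z)
      - (2 * ψ z - z * deriv ψ z) * (z * deriv δ z) = 0) :
    (∃ k : ℝ, ∀ z, γ z = k * z) ∧ (∃ k : ℝ, ∀ z, δ z = k) ∧
      ∃ k c : ℝ, ∀ z, ε z = k * z ^ 2 + c := by
  obtain ⟨cψ1, dψ⟩ := contDiff_hasDerivAt cψ
  obtain ⟨cψ2, dψ1⟩ := contDiff_hasDerivAt cψ1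
  obtain ⟨cψ3, dψ2⟩ := contDiff_hasDerivAt cψ2
  obtain ⟨cν1, dν⟩ := contDiff_hasDerivAt cν
  obtain ⟨cν2, dν1⟩ := contDiff_hasDerivAt cν1
  obtain ⟨cν3, dν2⟩ := contDiff_hasDerivAt cν2
  obtain ⟨cγ1, dγ⟩ := contDiff_hasDerivAt cγ
  obtain ⟨cγ2, dγ1⟩ := contDiff_hasDerivAt cγ1
  obtain ⟨cδ1, dδ⟩ := contDiff_hasDerivAt cδ
  obtain ⟨cδ2, dδ1⟩ := contDiff_hasDerivAt cδ1
  obtain ⟨cε1, dε⟩ := contDiff_hasDerivAt cε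
  obtain ⟨cε2, dε1⟩ := contDiff_hasDerivAt cε1
  set ψ1 := deriv ψ
  set ψ2 := deriv ψ1
  set ψ3 := deriv ψ2
  set ν1 := deriv ν
  set ν2 := deriv ν1
  set ν3 := deriv ν2
  set γ1 := deriv γ
  set γ2 := deriv γ1
  set δ1 := deriv δ
  set δ2 := deriv δ1
  set ε1 := deriv ε
  set ε2 := deriv ε1
  have kψ := cψ.continuous
  have kψ1 := cψ1.continuous
  have kψ2 := cψ2.continuous
  have kγ := cγ.continuous
  have kγ1 := cγ1.continuous
  have kγ2 := cγ2.continuous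
  have kδ1 := cδ1.continuous
  have did := fun z : ℝ => hasDerivAt_id' z
  have de := fun z : ℝ => ((dψ z).const_mul 2).fun_sub ((did z).fun_mul (dψ1 z))
  have hneq : ∀ z, ψ1 z - z * ψ2 z ≠ 0 → γ z - z * γ1 z = 0 ∧ z * δ1 z = 0 := by
    intro z hq
    refine radial_alternative (pψ z) hq (by linarith [B2 z]) ?_
    have := deriv_congr_on isOpen_univ (fun z _ => B2 z)
      (fun z => ((dψ1 z).fun_mul ((dγ z).fun_sub ((did z).fun_mul (dγ1 z)))).fun_sub
        ((de z).fun_mul ((did z).fun_mul (dδ1 z)))) (fun z => hasDerivAt_const z _) z trivial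
    linear_combination z * this + z ^ 2 * B1 z
  have heq : ∀ U : Set ℝ, IsOpen U → (∀ z ∈ U, z ≠ 0) → (∀ z ∈ U, ψ1 z - z * ψ2 z = 0) →
      ∀ z ∈ U, γ z - z * γ1 z = 0 ∧ z * δ1 z = 0 := by
    intro U hU h0 hq
    have hψ3 : ∀ z ∈ U, ψ3 z = 0 := by
      intro z hz
      have := deriv_congr_on hU hq (fun z => (dψ1 z).fun_sub ((did z).fun_mul (dψ2 z)))
        (fun z => hasDerivAt_const z _) z hz
      have h3 : z * ψ3 z = 0 := by linarith
      exact (mul_eq_zero.1 h3).resolve_left (h0 z hz)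
    have c0 : ∀ z ∈ U, ψ2 z * γ z = 1 / 2 * ν1 z := fun z hz => by
      have := S3 z
      rw [hq z hz] at this
      linarith
    have c1 : ∀ z ∈ U, ψ2 z * γ1 z = 1 / 2 * ν2 z := fun z hz => by
      have := deriv_congr_on hU c0 (fun z => (dψ2 z).fun_mul (dγ z))
        (fun z => (dν1 z).const_mul _) z hz
      rw [hψ3 z hz] at this
      linarith
    have c2 : ∀ z ∈ U, ψ2 z * γ2 z = 1 / 2 * ν3 z := fun z hz => by
      have := deriv_congr_on hU c1 (fun z => (dψ2 z).fun_mul (dγ1 z))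
        (fun z => (dν2 z).const_mul _) z hz
      rw [hψ3 z hz] at this
      linarith
    have d0 : ∀ z ∈ U, (2 * ψ z - z * ψ1 z) * δ z = 1 / 2 * (2 * ν z - z * ν1 z) :=
      fun z hz => by
        have := S4 z
        rw [hq z hz] at this
        linear_combination this - S5 z
    have d1 : ∀ z ∈ U, (2 * ψ z - z * ψ1 z) * δ1 z = 1 / 2 * (ν1 z - z * ν2 z) :=
      fun z hz => by
        have := deriv_congr_on hU d0 (fun z => (de z).fun_mul (dδ z))
          (fun z => (((dν z).const_mul 2).fun_sub ((did z).fun_mul (dν1 z))).const_mul _) z hz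
        linear_combination this - δ z * hq z hz
    have d2 : ∀ z ∈ U, (2 * ψ z - z * ψ1 z) * δ2 z = -(1 / 2) * (z * ν3 z) := fun z hz => by
      have := deriv_congr_on hU d1 (fun z => (de z).fun_mul (dδ1 z))
        (fun z => ((dν1 z).fun_sub ((did z).fun_mul (dν2 z))).const_mul _) z hz
      linear_combination this - δ1 z * hq z hz
    have e1 : ∀ z ∈ U, (2 * ψ z - z * ψ1 z) * ε1 z = -(1 / 2) * ν1 z := fun z hz => by
      have := deriv_congr_on hU (fun z _ => S5 z) (fun z => (de z).fun_mul (dε z))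
        (fun z => (dν z).const_mul _) z hz
      linear_combination this - ε z * hq z hz
    have e2 : ∀ z ∈ U, (2 * ψ z - z * ψ1 z) * ε2 z = -(1 / 2) * ν2 z := fun z hz => by
      have := deriv_congr_on hU e1 (fun z => (de z).fun_mul (dε1 z))
        (fun z => (dν1 z).const_mul _) z hz
      linear_combination this - ε1 z * hq z hz
    intro z hz
    -- On this set `B1` and `B2` hold identically and carry no information; the restriction on `ν`
    -- comes from `A2`.
    have m1 : ν1 z - z * ν2 z = 0 := by
      linear_combination -A2 z - z * γ2 z * hq z hz - z ^ 2 * c2 z hz - d1 z hz - z * d2 z hz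
        + e1 z hz - z * e2 z hz
    have hX : ψ2 z * (γ z - z * γ1 z) = 0 := by
      linear_combination c0 z hz - z * c1 z hz + 1 / 2 * m1
    have hY : (2 * ψ z - z * ψ1 z) * (z * δ1 z) = 0 := by
      linear_combination z * d1 z hz + 1 / 2 * z * m1
    exact ⟨(mul_eq_zero.1 hX).resolve_left (pψ2 z).ne', (mul_eq_zero.1 hY).resolve_left (pe z).ne'⟩
  have hX : ∀ z, γ z - z * γ1 z = 0 :=
    eq_zero_of_dense_cases (q := fun z => ψ1 z - z * ψ2 z)
      (kγ.sub (continuous_id.mul kγ1)) (fun z hz => (hneq z hz).1)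
      (fun U hU h0 hq z hz => (heq U hU h0 hq z hz).1)
  have hδ1 : ∀ z, δ1 z = 0 :=
    eq_zero_of_mul_eq_zero kδ1 (eq_zero_of_dense_cases (q := fun z => ψ1 z - z * ψ2 z)
      (continuous_id.mul kδ1) (fun z hz => (hneq z hz).2)
      (fun U hU h0 hq z hz => (heq U hU h0 hq z hz).2))
  have hγ2 : ∀ z, γ2 z = 0 := by
    refine eq_zero_of_mul_eq_zero kγ2 fun z => ?_
    have := deriv_congr_on isOpen_univ (fun z _ => hX z)
      (fun z => (dγ z).fun_sub ((did z).fun_mul (dγ1 z))) (fun z => hasDerivAt_const z _)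
      z trivial
    linarith
  have hγ1 : ∀ z, γ1 z = γ1 0 := eq_const_of_deriv fun z => by simpa [hγ2 z] using dγ1 z
  have hδ2 : ∀ z, δ2 z = 0 := fun z => by
    have : δ1 = fun _ => 0 := funext hδ1
    simp [δ2, this]
  refine ⟨⟨γ1 0, fun z => ?_⟩, ⟨δ 0, eq_const_of_deriv fun z => by simpa [hδ1 z] using dδ z⟩,
    quadratic_of_odd_deriv cε fun z => ?_⟩
  · linear_combination hX z + z * hγ1 z
  · have := A2 z
    rw [hγ2, hδ1, hδ2] at this
    have h2 : (2 * ψ z - z * ψ1 z) * (ε1 z - z * ε2 z) = 0 := by linarith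
    exact (mul_eq_zero.1 h2).resolve_left (pe z).ne'

end

/-! ### Axis vectors and the cylindrical form of the metric -/

/-- The vector with time component `a` and spatial component `b eᵢ`. -/
noncomputable def axisPoint (i : Fin n) (a b : ℝ) : Coord n := Fin.cons a (Pi.single i b)

@[simp] theorem axisPoint_zero (i : Fin n) (a b : ℝ) : axisPoint i a b 0 = a := rfl

@[simp] theorem axisPoint_succ (i j : Fin n) (a b : ℝ) :
    axisPoint i a b j.succ = if j = i then b else 0 := by
  simp [axisPoint, Pi.single_apply]

@[simp] theorem norm_spatial_axisPoint (i : Fin n) (a b : ℝ) :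
    ‖spatial (axisPoint i a b)‖ = |b| := by
  have h : spatial (axisPoint i a b) = EuclideanSpace.single i b := by
    ext j
    simp [spatial]
  rw [h, PiLp.norm_single, Real.norm_eq_abs]

theorem spatial_axisPoint_ne {i : Fin n} {a b : ℝ} (hb : b ≠ 0) :
    spatial (axisPoint i a b) ≠ 0 := by
  rw [← norm_pos_iff, norm_spatial_axisPoint]
  exact abs_pos.2 hb

theorem ne_zero_of_spatial_ne {y : Coord n} (hy : spatial y ≠ 0) : y ≠ 0 := by
  rintro rfl
  exact hy (by ext; simp [spatial])

theorem axisPoint_eq (i : Fin n) (a b : ℝ) :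
    axisPoint i a b = a • Pi.single 0 1 + b • Pi.single i.succ 1 := by
  ext A
  refine Fin.cases ?_ (fun j => ?_) A
  · simp [(Fin.succ_ne_zero _).symm]
  · simp [Pi.single_apply, Fin.succ_ne_zero]

theorem isOpen_cylinder {I : Set ℝ} (hI : IsOpen I) (ρ : ℝ) : IsOpen (cylinder n I ρ) :=
  (hI.preimage (continuous_apply 0)).inter
    (Metric.isOpen_ball.preimage contDiff_spatial.continuous)

theorem mem_cylinder_iff {I : Set ℝ} {ρ : ℝ} {x : Coord n} :
    x ∈ cylinder n I ρ ↔ x 0 ∈ I ∧ ‖spatial x‖ < ρ := by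
  simp [cylinder]

/-- `F(x, y) = |ȳ| φ(x⁰, |x̄|, y⁰/|ȳ|)` on the set `M`. -/
def IsCylindrical (M : Set (Coord n)) (F : Coord n → Coord n → ℝ) (φ : ℝ → ℝ → ℝ → ℝ) : Prop :=
  ∀ x ∈ M, ∀ y : Coord n, spatial y ≠ 0 →
    F x y = ‖spatial y‖ * φ (x 0) ‖spatial x‖ (y 0 / ‖spatial y‖)

section
variable {I : Set ℝ} {ρ : ℝ} {F : Coord n → Coord n → ℝ} {φ : ℝ → ℝ → ℝ → ℝ}

theorem isOpen_slit (hI : IsOpen I) : IsOpen (cylinder n I ρ ×ˢ ({0}ᶜ : Set (Coord n))) :=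
  (isOpen_cylinder hI ρ).prod isOpen_compl_singleton

theorem contDiffOn_sq (hF : IsFinslerMetric (cylinder n I ρ) F) :
    ContDiffOn ℝ ∞ (fun p : Coord n × Coord n => F p.1 p.2 ^ 2)
      (cylinder n I ρ ×ˢ ({0}ᶜ : Set (Coord n))) := hF.smooth.pow 2

theorem contDiff_comp_axisPoint (hI : IsOpen I) {f : Coord n × Coord n → ℝ}
    (hf : ContDiffOn ℝ ∞ f (cylinder n I ρ ×ˢ ({0}ᶜ : Set (Coord n)))) {x : Coord n}
    (hx : x ∈ cylinder n I ρ) (i : Fin n) : ContDiff ℝ ∞ fun z => f (x, axisPoint i z 1) := by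
  rw [contDiff_iff_contDiffAt]
  intro z
  have h1 : ContDiffAt ℝ ∞ f (x, axisPoint i z 1) := hf.contDiffAt ((isOpen_slit hI).mem_nhds
    ⟨hx, ne_zero_of_spatial_ne (spatial_axisPoint_ne one_ne_zero)⟩)
  have h2 : ContDiff ℝ ∞ fun z : ℝ => (x, axisPoint i z 1) := by
    simp_rw [axisPoint_eq]
    fun_prop
  exact h1.comp z h2.contDiffAt

theorem IsCylindrical.eq_axisPoint (hφ : IsCylindrical (cylinder n I ρ) F φ) (i : Fin n)
    {x : Coord n} (hx : x ∈ cylinder n I ρ) (z : ℝ) :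
    F x (axisPoint i z 1) = φ (x 0) ‖spatial x‖ z := by
  rw [hφ x hx _ (spatial_axisPoint_ne one_ne_zero)]
  simp

theorem IsCylindrical.sq_eq_radial (hφ : IsCylindrical (cylinder n I ρ) F φ)
    {x : Coord n} (hx : x ∈ cylinder n I ρ) {y : Coord n} (hy : spatial y ≠ 0) :
    F x y ^ 2 = radial 2 (fun z => φ (x 0) ‖spatial x‖ z ^ 2) y := by
  rw [hφ x hx _ hy, radial, mul_pow]
  rfl

theorem IsCylindrical.contDiff_sq (hI : IsOpen I) (hF : IsFinslerMetric (cylinder n I ρ) F)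
    (hφ : IsCylindrical (cylinder n I ρ) F φ) (i : Fin n) {x : Coord n}
    (hx : x ∈ cylinder n I ρ) : ContDiff ℝ ∞ fun z => φ (x 0) ‖spatial x‖ z ^ 2 := by
  have h := contDiff_comp_axisPoint hI (contDiffOn_sq hF) hx i
  simpa only [hφ.eq_axisPoint i hx] using h

/-- `μ` and `ν` are the `t`- and `r`-derivatives of `φ²`. Since `φ` is not assumed smooth, they are
defined as derivatives of `F²` at an axis point, from which they inherit smoothness. -/
theorem IsCylindrical.exists_pd_fst (hI : IsOpen I) (hF : IsFinslerMetric (cylinder n I ρ) F)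
    (hφ : IsCylindrical (cylinder n I ρ) F φ) (i : Fin n) {t r : ℝ} (hr : 0 < r)
    (htr : axisPoint i t r ∈ cylinder n I ρ) :
    ∃ μ ν : ℝ → ℝ, ContDiff ℝ ∞ μ ∧ ContDiff ℝ ∞ ν ∧ ∀ x ∈ cylinder n I ρ, x 0 = t →
      ‖spatial x‖ = r → ∀ y, spatial y ≠ 0 → pd 0 (fun x' => F x' y ^ 2) x = radial 2 μ y ∧
        ∀ j : Fin n, pd j.succ (fun x' => F x' y ^ 2) x = x j.succ / r * radial 2 ν y := by
  have hU := isOpen_slit (n := n) (ρ := ρ) hI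
  have hK := contDiffOn_sq hF
  refine ⟨fun z => pd 0 (fun x' => F x' (axisPoint i z 1) ^ 2) (axisPoint i t r),
    fun z => pd i.succ (fun x' => F x' (axisPoint i z 1) ^ 2) (axisPoint i t r),
    contDiff_comp_axisPoint hI (contDiffOn_pd_fst hU 0 hK) htr i,
    contDiff_comp_axisPoint hI (contDiffOn_pd_fst hU i.succ hK) htr i, ?_⟩
  intro x hx hx0 hxr y hy
  have hxs : spatial x ≠ 0 := by rw [← norm_pos_iff, hxr]; exact hr
  set z := y 0 / ‖spatial y‖
  set k : Coord n → ℝ := fun x' => F x' (axisPoint i z 1) ^ 2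
  have hk : DifferentiableAt ℝ k (axisPoint i t r) := by
    have h1 := (hK.contDiffAt (hU.mem_nhds (x := (axisPoint i t r, axisPoint i z 1))
      ⟨htr, ne_zero_of_spatial_ne (spatial_axisPoint_ne one_ne_zero)⟩)).differentiableAt
      (by simp)
    exact h1.comp (axisPoint i t r) (f := fun x' => (x', axisPoint i z 1)) (by fun_prop)
  -- Moving `x'` to the `i`-th axis preserves `x⁰` and `|x̄|`, hence `F²`, so the chain rule through
  -- `s` transports the derivatives at the axis point to `x`.
  set s : Coord n → Coord n := fun x' => axisPoint i (x' 0) ‖spatial x'‖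
  have hsx : s x = axisPoint i t r := by simp [s, hx0, hxr]
  have hs : HasFDerivAt s ((fderiv ℝ (fun x' : Coord n => x' 0) x).smulRight (Pi.single 0 1)
      + (fderiv ℝ (fun x' : Coord n => ‖spatial x'‖) x).smulRight (Pi.single i.succ 1)) x := by
    simp only [s, axisPoint_eq]
    exact ((differentiable_coord 0 x).hasFDerivAt.smul_const _).add
      ((differentiableAt_norm_spatial hxs).hasFDerivAt.smul_const _)
  have he : (fun x' => F x' y ^ 2) =ᶠ[𝓝 x] fun x' => ‖spatial y‖ ^ 2 * k (s x') := by
    filter_upwards [(isOpen_cylinder hI ρ).mem_nhds hx] with x' hx'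
    have hs' : s x' ∈ cylinder n I ρ := by
      rw [mem_cylinder_iff] at hx' ⊢
      simpa [s] using hx'
    simp only [k]
    rw [hφ.eq_axisPoint i hs', hφ x' hx' y hy]
    simp [s, mul_pow, z]
  have hd : HasFDerivAt (fun x' => ‖spatial y‖ ^ 2 * k (s x')) _ x :=
    ((hsx ▸ hk).hasFDerivAt.comp x hs).const_mul (‖spatial y‖ ^ 2)
  have key : ∀ A, pd A (fun x' => F x' y ^ 2) x = ‖spatial y‖ ^ 2 *
      (pd A (fun x' : Coord n => x' 0) x * pd 0 k (axisPoint i t r)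
        + pd A (fun x' : Coord n => ‖spatial x'‖) x * pd i.succ k (axisPoint i t r)) := by
    intro A
    rw [pd_congr A he, pd, hd.fderiv, hsx]
    simp [pd]
    ring
  refine ⟨?_, fun j => ?_⟩
  · rw [key, pd_coord, pd_norm_spatial _ hxs, radial]
    simp [k, z]
  · rw [key, pd_coord, pd_norm_spatial _ hxs, radial, hxr]
    simp [k, z, Fin.succ_ne_zero]
    ring

end

/-! ### The fundamental tensor and convexity -/

section
variable {ψ : ℝ → ℝ} {f : Coord n → ℝ}

theorem deriv_two_mul_sub (cψ : ContDiff ℝ ∞ ψ) (z : ℝ) :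
    deriv (fun z => 2 * ψ z - z * deriv ψ z) z = deriv ψ z - z * deriv (deriv ψ) z := by
  obtain ⟨cψ1, dψ⟩ := contDiff_hasDerivAt cψ
  obtain ⟨cψ2, dψ1⟩ := contDiff_hasDerivAt cψ1
  have := (((dψ z).const_mul 2).fun_sub ((hasDerivAt_id' z).fun_mul (dψ1 z))).deriv
  rw [this]
  ring

theorem hasPd_zero_radial_two (cψ : ContDiff ℝ ∞ ψ)
    (hf : ∀ y, spatial y ≠ 0 → f y = radial 2 ψ y) : HasPd 0 f (radial 1 (deriv ψ)) :=
  (hasPd_zero_radial 2 (cψ.differentiable (by simp))).congr hf (fun _ _ => rfl)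

theorem hasPd_succ_radial_two (cψ : ContDiff ℝ ∞ ψ)
    (hf : ∀ y, spatial y ≠ 0 → f y = radial 2 ψ y) (i : Fin n) :
    HasPd i.succ f (fun y => y i.succ * radial 0 (fun z => 2 * ψ z - z * deriv ψ z) y) :=
  (hasPd_succ_radial i 2 (cψ.differentiable (by simp))).congr hf (fun _ _ => by simp)

section
variable (cψ : ContDiff ℝ ∞ ψ) (hf : ∀ y, spatial y ≠ 0 → f y ^ 2 = radial 2 ψ y)
  {y : Coord n} (hy : spatial y ≠ 0)
include cψ hf hy

theorem fundamentalMatrix_zero_zero :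
    fundamentalMatrix f y 0 0 = 1 / 2 * deriv (deriv ψ) (y 0 / ‖spatial y‖) := by
  have h := (hasPd_zero_radial_two cψ hf).pd
    (hasPd_zero_radial 1 ((contDiff_hasDerivAt cψ).1.differentiable (by simp)))
  rw [fundamentalMatrix, Matrix.of_apply, (h y hy).2]
  simp [radial]

theorem fundamentalMatrix_succ_zero (i : Fin n) :
    fundamentalMatrix f y i.succ 0 = 1 / 2 * (y i.succ / ‖spatial y‖ *
      (deriv ψ (y 0 / ‖spatial y‖)
        - y 0 / ‖spatial y‖ * deriv (deriv ψ) (y 0 / ‖spatial y‖))) := by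
  have h := (hasPd_zero_radial_two cψ hf).pd
    (hasPd_succ_radial i 1 ((contDiff_hasDerivAt cψ).1.differentiable (by simp)))
  rw [fundamentalMatrix, Matrix.of_apply, (h y hy).2]
  have := (norm_spatial_pos hy).ne'
  simp only [radial, show (1 - 2 : ℤ) = -1 by norm_num, zpow_neg_one, Int.cast_one, one_mul]
  field_simp

theorem fundamentalMatrix_zero_succ (i : Fin n) :
    fundamentalMatrix f y 0 i.succ = 1 / 2 * (y i.succ / ‖spatial y‖ *
      (deriv ψ (y 0 / ‖spatial y‖)
        - y 0 / ‖spatial y‖ * deriv (deriv ψ) (y 0 / ‖spatial y‖))) := by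
  have c1 := (contDiff_hasDerivAt cψ).1.differentiable (by simp)
  have h := (hasPd_succ_radial_two cψ hf i).pd ((hasPd_coord 0 i.succ).mul
    (hasPd_zero_radial 0 (((cψ.differentiable (by simp)).const_mul 2).fun_sub
      (differentiable_id.fun_mul c1))))
  rw [fundamentalMatrix, Matrix.of_apply, (h y hy).2]
  have := (norm_spatial_pos hy).ne'
  simp only [radial, show (0 - 1 : ℤ) = -1 by norm_num, zpow_neg_one,
    if_neg (Fin.succ_ne_zero i).symm, mul_zero, add_zero]
  rw [deriv_two_mul_sub cψ]
  field_simp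

theorem fundamentalMatrix_succ_succ (i j : Fin n) :
    fundamentalMatrix f y i.succ j.succ = 1 / 2 * ((if i = j then 1 else 0) *
      (2 * ψ (y 0 / ‖spatial y‖) - y 0 / ‖spatial y‖ * deriv ψ (y 0 / ‖spatial y‖))
      - y i.succ * y j.succ / ‖spatial y‖ ^ 2 * (y 0 / ‖spatial y‖ *
      (deriv ψ (y 0 / ‖spatial y‖)
        - y 0 / ‖spatial y‖ * deriv (deriv ψ) (y 0 / ‖spatial y‖)))) := by
  have c1 := (contDiff_hasDerivAt cψ).1.differentiable (by simp)
  have h := (hasPd_succ_radial_two cψ hf j).pd ((hasPd_coord i.succ j.succ).mul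
    (hasPd_succ_radial i 0 (((cψ.differentiable (by simp)).const_mul 2).fun_sub
      (differentiable_id.fun_mul c1))))
  rw [fundamentalMatrix, Matrix.of_apply, (h y hy).2]
  have := (norm_spatial_pos hy).ne'
  simp only [radial, show (0 - 2 : ℤ) = -2 by norm_num, zpow_neg, zpow_zero, Fin.succ_inj]
  rw [deriv_two_mul_sub cψ, show ‖spatial y‖ ^ (2 : ℤ) = ‖spatial y‖ ^ 2 from rfl]
  split_ifs
  · push_cast
    field_simp
    ring
  · push_cast
    field_simp
    ring

end

/-- At `y = (z, eᵢ)` the transverse entry `g_jj` is `(2ψ - zψ')/2`, which is where two spatial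
dimensions are needed. The last inequality is positivity of the determinant of the `(0, i)` block.
-/
theorem radial_convexity (cψ : ContDiff ℝ ∞ ψ) (hf : ∀ y, spatial y ≠ 0 → f y ^ 2 = radial 2 ψ y)
    (hm : IsMinkowskiNorm f) {i j : Fin n} (hij : i ≠ j) (z : ℝ) :
    0 < ψ z ∧ 0 < 2 * ψ z - z * deriv ψ z ∧ 0 < deriv (deriv ψ) z ∧
      0 < 2 * ψ z * deriv (deriv ψ) z - deriv ψ z ^ 2 := by
  set y := axisPoint i z 1
  have hy : spatial y ≠ 0 := spatial_axisPoint_ne one_ne_zero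
  have hy0 := ne_zero_of_spatial_ne hy
  have hv : ‖spatial y‖ = 1 := by simp [y]
  have hz : y 0 = z := rfl
  have hyi : y i.succ = 1 := by simp [y]
  have hyj : y j.succ = 0 := by simp [y, hij.symm]
  have hg := hm.stronglyConvex y hy0
  have h1 : 0 < ψ z := by
    have := hf y hy
    simp only [radial, hv, hz] at this
    simp at this
    rw [← this]
    exact pow_pos (hm.pos y hy0) 2
  have h2 := hg.diag_pos (i := j.succ)
  rw [fundamentalMatrix_succ_succ cψ hf hy, hv, hz, hyj] at h2
  have h3 := hg.diag_pos (i := 0)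
  rw [fundamentalMatrix_zero_zero cψ hf hy, hv, hz] at h3
  simp at h2 h3
  refine ⟨h1, by simpa using h2, h3, ?_⟩
  set ψ2 := deriv (deriv ψ) z
  set q := deriv ψ z - z * ψ2
  -- The vector `(-q, ψ'')` is chosen so that the block's quadratic form on it is `ψ''` times its
  -- determinant, up to a positive constant.
  have h4 := (Matrix.posDef_iff_dotProduct_mulVec.1 hg).2 (x := Pi.single 0 (-q) + Pi.single i.succ ψ2) (by
    intro h
    have := congrFun h i.succ
    simp [Fin.succ_ne_zero] at this
    exact h3.ne' this)
  simp [Matrix.mulVec_add, add_dotProduct, Matrix.mulVec_single, dotProduct_add] at h4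
  rw [fundamentalMatrix_zero_zero cψ hf hy, fundamentalMatrix_succ_succ cψ hf hy,
    fundamentalMatrix_zero_succ cψ hf hy, fundamentalMatrix_succ_zero cψ hf hy, hv, hz, hyi] at h4
  simp at h4
  have h5 : 0 < ψ2 * (2 * ψ z * ψ2 - deriv ψ z ^ 2) := by
    have e1 : deriv ψ z = q + z * ψ2 := by simp [q]
    simp only [e1] at h4 ⊢
    have e2 : deriv (deriv ψ) z = ψ2 := rfl
    simp only [e2] at h4
    nlinarith
  exact pos_of_mul_pos_right h5 h3.le

end

/-! ### The spray in terms of profile functions -/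

/-- Cramer's rule: `(α, β)` and `(γ, δ + ε)` solve systems with the same matrix, of determinant
`2ψψ'' - ψ'²`. The component along `x̄` gives `ε` separately, by division by `2ψ - zψ'`. -/
theorem exists_spray_profiles {ψ μ ν : ℝ → ℝ} (cψ : ContDiff ℝ ∞ ψ) (cμ : ContDiff ℝ ∞ μ)
    (cν : ContDiff ℝ ∞ ν) (pe : ∀ z, 0 < 2 * ψ z - z * deriv ψ z)
    (pΔ : ∀ z, 0 < 2 * ψ z * deriv (deriv ψ) z - deriv ψ z ^ 2) :
    ∃ α β γ δ ε : ℝ → ℝ, (ContDiff ℝ ∞ α ∧ ContDiff ℝ ∞ β ∧ ContDiff ℝ ∞ γ ∧ ContDiff ℝ ∞ δ ∧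
      ContDiff ℝ ∞ ε) ∧
    (∀ z, deriv (deriv ψ) z * α z + (deriv ψ z - z * deriv (deriv ψ) z) * β z
      = 1 / 2 * (z * deriv μ z - μ z)) ∧
    (∀ z, (deriv ψ z - z * deriv (deriv ψ) z) * α z
      + (2 * ψ z - z * deriv ψ z - z * (deriv ψ z - z * deriv (deriv ψ) z)) * β z
      = 1 / 2 * (z * (2 * μ z - z * deriv μ z))) ∧
    (∀ z, deriv (deriv ψ) z * γ z + (deriv ψ z - z * deriv (deriv ψ) z) * (δ z + ε z)
      = 1 / 2 * deriv ν z) ∧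
    (∀ z, (deriv ψ z - z * deriv (deriv ψ) z) * γ z
      + (2 * ψ z - z * deriv ψ z - z * (deriv ψ z - z * deriv (deriv ψ) z)) * (δ z + ε z)
      = 1 / 2 * (ν z - z * deriv ν z)) ∧
    ∀ z, (2 * ψ z - z * deriv ψ z) * ε z = -(1 / 2) * ν z := by
  have cψ1 := (contDiff_hasDerivAt cψ).1
  have cψ2 := (contDiff_hasDerivAt cψ1).1
  have cμ1 := (contDiff_hasDerivAt cμ).1
  have cν1 := (contDiff_hasDerivAt cν).1
  have solve : ∀ R₁ R₂ : ℝ → ℝ, ContDiff ℝ ∞ R₁ → ContDiff ℝ ∞ R₂ → ∃ a b : ℝ → ℝ,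
      ContDiff ℝ ∞ a ∧ ContDiff ℝ ∞ b ∧ ∀ z,
      deriv (deriv ψ) z * a z + (deriv ψ z - z * deriv (deriv ψ) z) * b z = R₁ z ∧
      (deriv ψ z - z * deriv (deriv ψ) z) * a z
      + (2 * ψ z - z * deriv ψ z - z * (deriv ψ z - z * deriv (deriv ψ) z)) * b z = R₂ z := by
    intro R₁ R₂ h1 h2
    refine ⟨fun z => ((2 * ψ z - z * deriv ψ z - z * (deriv ψ z - z * deriv (deriv ψ) z)) * R₁ z
        - (deriv ψ z - z * deriv (deriv ψ) z) * R₂ z)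
        / (2 * ψ z * deriv (deriv ψ) z - deriv ψ z ^ 2),
      fun z => (deriv (deriv ψ) z * R₂ z - (deriv ψ z - z * deriv (deriv ψ) z) * R₁ z)
        / (2 * ψ z * deriv (deriv ψ) z - deriv ψ z ^ 2), ?_, ?_, fun z => ?_⟩
    · exact ContDiff.div (by fun_prop) (by fun_prop) fun z => (pΔ z).ne'
    · exact ContDiff.div (by fun_prop) (by fun_prop) fun z => (pΔ z).ne'
    · have := (pΔ z).ne'
      constructor <;>
        (rw [mul_div_assoc', mul_div_assoc', ← add_div, div_eq_iff this]; ring)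
  obtain ⟨α, β, cα, cβ, h1⟩ := solve (fun z => 1 / 2 * (z * deriv μ z - μ z))
    (fun z => 1 / 2 * (z * (2 * μ z - z * deriv μ z))) (by fun_prop) (by fun_prop)
  obtain ⟨γ, η, cγ, cη, h2⟩ := solve (fun z => 1 / 2 * deriv ν z)
    (fun z => 1 / 2 * (ν z - z * deriv ν z)) (by fun_prop) (by fun_prop)
  have cε : ContDiff ℝ ∞ fun z => -(1 / 2) * ν z / (2 * ψ z - z * deriv ψ z) :=
    ContDiff.div (by fun_prop) (by fun_prop) fun z => (pe z).ne'
  refine ⟨α, β, γ, fun z => η z - -(1 / 2) * ν z / (2 * ψ z - z * deriv ψ z),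
    fun z => -(1 / 2) * ν z / (2 * ψ z - z * deriv ψ z), ⟨cα, cβ, cγ, cη.sub cε, cε⟩,
    fun z => (h1 z).1, fun z => (h1 z).2, fun z => ?_, fun z => ?_, fun z => ?_⟩
  · simpa using (h2 z).1
  · simpa using (h2 z).2
  · have := (pe z).ne'
    field_simp

/-- The radial component `⟨x̄, ȳ⟩ / r`. -/
noncomputable def axialComponent (x : Coord n) (r : ℝ) (y : Coord n) : ℝ :=
  ∑ j : Fin n, x j.succ / r * y j.succ

/-- The spray of a cylindrical metric in terms of its profile functions. -/
noncomputable def profileSpray (α β γ δ ε : ℝ → ℝ) (x : Coord n) (r : ℝ) (y : Coord n) :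
    Coord n :=
  Fin.cons (radial 2 α y + axialComponent x r y * radial 1 γ y)
    (fun j => y j.succ * radial 1 β y + y j.succ * axialComponent x r y * radial 0 δ y
      + x j.succ / r * radial 2 ε y)

theorem IsCylindrical.spray_eq {I : Set ℝ} {ρ : ℝ} {F : Coord n → Coord n → ℝ}
    {φ : ℝ → ℝ → ℝ → ℝ} (hI : IsOpen I) (hF : IsFinslerMetric (cylinder n I ρ) F)
    (hφ : IsCylindrical (cylinder n I ρ) F φ) {t r : ℝ}
    {ψ μ ν α β γ δ ε : ℝ → ℝ} (cψ : ContDiff ℝ ∞ ψ) (cμ : ContDiff ℝ ∞ μ) (cν : ContDiff ℝ ∞ ν)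
    (hψ : ∀ z, ψ z = φ t r z ^ 2)
    {x : Coord n} (hx : x ∈ cylinder n I ρ) (hx0 : x 0 = t) (hxr : ‖spatial x‖ = r)
    (hμ : ∀ y, spatial y ≠ 0 → pd 0 (fun x' => F x' y ^ 2) x = radial 2 μ y)
    (hν : ∀ y, spatial y ≠ 0 → ∀ j : Fin n,
      pd j.succ (fun x' => F x' y ^ 2) x = x j.succ / r * radial 2 ν y)
    (S1 : ∀ z, deriv (deriv ψ) z * α z + (deriv ψ z - z * deriv (deriv ψ) z) * β z
      = 1 / 2 * (z * deriv μ z - μ z))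
    (S2 : ∀ z, (deriv ψ z - z * deriv (deriv ψ) z) * α z
      + (2 * ψ z - z * deriv ψ z - z * (deriv ψ z - z * deriv (deriv ψ) z)) * β z
      = 1 / 2 * (z * (2 * μ z - z * deriv μ z)))
    (S3 : ∀ z, deriv (deriv ψ) z * γ z + (deriv ψ z - z * deriv (deriv ψ) z) * (δ z + ε z)
      = 1 / 2 * deriv ν z)
    (S4 : ∀ z, (deriv ψ z - z * deriv (deriv ψ) z) * γ z
      + (2 * ψ z - z * deriv ψ z - z * (deriv ψ z - z * deriv (deriv ψ) z)) * (δ z + ε z)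
      = 1 / 2 * (ν z - z * deriv ν z))
    (S5 : ∀ z, (2 * ψ z - z * deriv ψ z) * ε z = -(1 / 2) * ν z)
    {y : Coord n} (hy : spatial y ≠ 0) (A : Fin (n + 1)) :
    spray F A x y = profileSpray α β γ δ ε x r y A := by
  have hU := isOpen_slit (n := n) (ρ := ρ) hI
  have hf : ∀ y, spatial y ≠ 0 → F x y ^ 2 = radial 2 ψ y := fun y hy => by
    rw [hφ.sq_eq_radial hx hy, hx0, hxr, funext hψ]
  have hy0 := ne_zero_of_spatial_ne hy
  have hg := (hF.minkowski x hx).stronglyConvex y hy0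
  have hv := norm_spatial_pos hy
  have hvs := norm_spatial_sq y
  have hsw : ∀ B C, pd C (fun x' => pd B (fun w => F x' w ^ 2) y) x
      = pd B (fun w => pd C (fun x' => F x' w ^ 2) x) y := fun B C =>
    pd_fst_pd_snd_comm hU (contDiffOn_sq hF) (x := x) (y := y) ⟨hx, hy0⟩ C B
  have m0 := (hasPd_zero_radial_two cμ hμ y hy).2
  have mj := fun j => (hasPd_succ_radial_two cμ hμ j y hy).2
  have n0 : ∀ k : Fin n, pd 0 (fun w => pd k.succ (fun x' => F x' w ^ 2) x) y
      = x k.succ / r * radial 1 (deriv ν) y := fun k => by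
    have := (((hasPd_const 0 (x k.succ / r)).mul
      (hasPd_zero_radial_two cν (fun _ _ => rfl))).congr (fun y hy => hν y hy k)
      (fun _ _ => rfl) y hy).2
    simpa using this
  have nj : ∀ j k : Fin n, pd j.succ (fun w => pd k.succ (fun x' => F x' w ^ 2) x) y
      = x k.succ / r * (y j.succ * radial 0 (fun z => 2 * ν z - z * deriv ν z) y) :=
    fun j k => by
      have := (((hasPd_const j.succ (x k.succ / r)).mul
        (hasPd_succ_radial_two cν (fun _ _ => rfl) j)).congr (fun y hy => hν y hy k)
        (fun _ _ => rfl) y hy).2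
      simpa using this
  set v := ‖spatial y‖ with hvdef
  set z := y 0 / v with hz
  have hyz : y 0 = z * v := by rw [hz]; field_simp
  set w := axialComponent x r y with hw
  have hw' : w = ∑ j : Fin n, x j.succ / r * y j.succ := rfl
  clear_value w z v
  -- It suffices to check the spray equations before inverting `g`. Sorting them by the coefficients
  -- `yʲ`, `yʲ w` and `xʲ/r` gives exactly `S1`–`S5`.
  have hR : ∀ B, ∑ C, fundamentalMatrix (F x) y B C * profileSpray α β γ δ ε x r y C
      = 1 / 4 * ((∑ C, pd C (fun x' => pd B (fun w => F x' w ^ 2) y) x * y C)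
      - pd B (fun x' => F x' y ^ 2) x) := by
    intro B
    simp_rw [hsw]
    rw [Fin.sum_univ_succ, Fin.sum_univ_succ]
    have r0 : ∀ h : ℝ → ℝ, radial 0 h y = h z := fun h => by simp [radial, hz, hvdef]
    have r1 : ∀ h : ℝ → ℝ, radial 1 h y = v * h z := fun h => by simp [radial, hz, hvdef]
    have r2 : ∀ h : ℝ → ℝ, radial 2 h y = v ^ 2 * h z := fun h => by
      rw [radial, hz, hvdef]
      rfl
    have wy : ∀ c : ℝ, ∑ k : Fin n, x k.succ / r * c * y k.succ = w * c := fun c => by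
      rw [hw', Finset.sum_mul]
      exact Finset.sum_congr rfl fun k _ => by ring
    have yG : ∀ c : ℝ, ∑ k : Fin n, c * y k.succ * (y k.succ * (v * β z)
        + y k.succ * w * δ z + x k.succ / r * (v ^ 2 * ε z))
        = c * (v ^ 2 * (v * β z + w * δ z) + w * (v ^ 2 * ε z)) := fun c => by
      have h1 : ∀ k : Fin n, c * y k.succ * (y k.succ * (v * β z) + y k.succ * w * δ z
          + x k.succ / r * (v ^ 2 * ε z)) = c * (v * β z + w * δ z) * y k.succ ^ 2
          + c * (v ^ 2 * ε z) * (x k.succ / r * y k.succ) := fun k => by ring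
      simp_rw [h1]
      rw [Finset.sum_add_distrib, ← Finset.mul_sum, ← Finset.mul_sum, ← hvs, ← hw']
      ring
    refine Fin.cases ?_ (fun j => ?_) B
    · rw [m0, hμ y hy, fundamentalMatrix_zero_zero cψ hf hy]
      simp_rw [n0, fundamentalMatrix_zero_succ cψ hf hy]
      simp only [profileSpray, Fin.cons_zero, Fin.cons_succ, r0, r1, r2, ← hvdef, ← hz, ← hw, wy]
      have := yG (1 / 2 / v * (deriv ψ z - z * deriv (deriv ψ) z))
      rw [show (∑ k : Fin n, 1 / 2 * (y k.succ / v * (deriv ψ z - z * deriv (deriv ψ) z)) *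
        (y k.succ * (v * β z) + y k.succ * w * δ z + x k.succ / r * (v ^ 2 * ε z))) = _ from
        (Finset.sum_congr rfl fun k _ => by ring).trans this, hyz]
      field_simp
      linear_combination 4 * v * S1 z + 4 * w * S3 z
    · rw [mj, hν y hy, fundamentalMatrix_succ_zero cψ hf hy]
      simp_rw [nj, fundamentalMatrix_succ_succ cψ hf hy]
      simp only [profileSpray, Fin.cons_zero, Fin.cons_succ, r0, r1, r2, ← hvdef, ← hz, ← hw, wy]
      have := yG (-(1 / 2) * y j.succ / v ^ 2 * (z * (deriv ψ z - z * deriv (deriv ψ) z)))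
      have hδ : ∑ k : Fin n, (if j = k then 1 else 0) * (1 / 2 * (2 * ψ z - z * deriv ψ z) *
          (y k.succ * (v * β z) + y k.succ * w * δ z + x k.succ / r * (v ^ 2 * ε z)))
          = 1 / 2 * (2 * ψ z - z * deriv ψ z) *
          (y j.succ * (v * β z) + y j.succ * w * δ z + x j.succ / r * (v ^ 2 * ε z)) := by
        simp
      have hsum := congrArg₂ (· + ·) hδ this
      rw [← Finset.sum_add_distrib] at hsum
      rw [show (∑ k : Fin n, 1 / 2 * ((if j = k then 1 else 0) * (2 * ψ z - z * deriv ψ z)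
        - y j.succ * y k.succ / v ^ 2 * (z * (deriv ψ z - z * deriv (deriv ψ) z))) *
        (y k.succ * (v * β z) + y k.succ * w * δ z + x k.succ / r * (v ^ 2 * ε z))) = _ from
        (Finset.sum_congr rfl fun k _ => by ring).trans hsum, hyz]
      generalize x j.succ / r = xj
      field_simp
      linear_combination 4 * y j.succ * v * S2 z + 4 * y j.succ * w * (S4 z - S5 z)
        + 4 * xj * v ^ 2 * S5 z
  have hinv : (fundamentalMatrix (F x) y)⁻¹ * fundamentalMatrix (F x) y = 1 :=
    Matrix.nonsing_inv_mul _ hg.det_pos.ne'.isUnit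
  have h1 : spray F A x y = ((fundamentalMatrix (F x) y)⁻¹).mulVec
      ((fundamentalMatrix (F x) y).mulVec (profileSpray α β γ δ ε x r y)) A := by
    rw [spray, Finset.mul_sum]
    refine Finset.sum_congr rfl fun B _ => ?_
    have := hR B
    simp only [Matrix.mulVec, dotProduct] at this ⊢
    rw [this]
    ring
  rw [h1, Matrix.mulVec_mulVec, hinv, Matrix.one_mulVec]

/-! ### Smoothness of the spray -/

theorem contDiffOn_det {E ι : Type*} [NormedAddCommGroup E] [NormedSpace ℝ E] [Fintype ι]
    [DecidableEq ι] {U : Set E} {M : E → Matrix ι ι ℝ}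
    (h : ∀ i j, ContDiffOn ℝ ∞ (fun p => M p i j) U) :
    ContDiffOn ℝ ∞ (fun p => (M p).det) U := by
  simp_rw [Matrix.det_apply']
  exact ContDiffOn.sum fun σ _ => contDiffOn_const.mul (contDiffOn_prod fun i _ => h _ _)

theorem contDiffOn_inv {E ι : Type*} [NormedAddCommGroup E] [NormedSpace ℝ E] [Fintype ι]
    [DecidableEq ι] {U : Set E} {M : E → Matrix ι ι ℝ}
    (h : ∀ i j, ContDiffOn ℝ ∞ (fun p => M p i j) U) (h0 : ∀ p ∈ U, (M p).det ≠ 0) (i j : ι) :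
    ContDiffOn ℝ ∞ (fun p => (M p)⁻¹ i j) U := by
  simp_rw [Matrix.inv_def, Matrix.smul_apply, Matrix.adjugate_apply, Ring.inverse_eq_inv',
    smul_eq_mul]
  refine ((contDiffOn_det h).inv h0).mul (contDiffOn_det fun k l => ?_)
  simp_rw [Matrix.updateRow_apply]
  split_ifs
  · exact contDiffOn_const
  · exact h k l

section
variable {I : Set ℝ} {ρ : ℝ} {F : Coord n → Coord n → ℝ} {φ : ℝ → ℝ → ℝ → ℝ}

theorem contDiffOn_spray (hI : IsOpen I) (hF : IsFinslerMetric (cylinder n I ρ) F)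
    (A : Fin (n + 1)) : ContDiffOn ℝ ∞ (fun p : Coord n × Coord n => spray F A p.1 p.2)
      (cylinder n I ρ ×ˢ ({0}ᶜ : Set (Coord n))) := by
  have hU := isOpen_slit (n := n) (ρ := ρ) hI
  have hK := contDiffOn_sq hF
  have h1 := fun B => contDiffOn_pd_snd hU B hK
  have h2 := fun A B => contDiffOn_pd_snd hU A (h1 B)
  have h3 := fun C B => contDiffOn_pd_fst hU C (h1 B)
  have h4 := fun B => contDiffOn_pd_fst hU B hK
  have hinv := contDiffOn_inv (M := fun p : Coord n × Coord n => fundamentalMatrix (F p.1) p.2)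
    (fun i j => contDiffOn_const.mul (h2 i j))
    (fun p hp => ((hF.minkowski p.1 hp.1).stronglyConvex p.2 hp.2).det_pos.ne')
  refine contDiffOn_const.mul (ContDiffOn.sum fun B _ => (hinv A B).mul
    ((ContDiffOn.sum fun C _ => (h3 C B).mul ?_).sub (h4 B)))
  exact ContDiff.contDiffOn (by fun_prop)

theorem continuousOn_berwald (hI : IsOpen I) (hF : IsFinslerMetric (cylinder n I ρ) F)
    (A B C D : Fin (n + 1)) :
    ContinuousOn (fun p : Coord n × Coord n => berwald F A B C D p.1 p.2)
      (cylinder n I ρ ×ˢ ({0}ᶜ : Set (Coord n))) := by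
  have hU := isOpen_slit (n := n) (ρ := ρ) hI
  exact (contDiffOn_pd_snd hU B (contDiffOn_pd_snd hU C (contDiffOn_pd_snd hU D
    (contDiffOn_spray hI hF A)))).continuousOn

end

/-! ### Third derivatives -/

/-- `g = ∂³f/∂v^A∂v^B∂v^C` at all vectors with nonzero spatial part. -/
def HasThirdPd (A B C : Fin (n + 1)) (f g : Coord n → ℝ) : Prop :=
  ∃ f₁ f₂, HasPd C f f₁ ∧ HasPd B f₁ f₂ ∧ HasPd A f₂ g

section
variable {A B C : Fin (n + 1)} {f f' g g' : Coord n → ℝ}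

theorem HasThirdPd.add (h : HasThirdPd A B C f g) (h' : HasThirdPd A B C f' g') :
    HasThirdPd A B C (fun y => f y + f' y) (fun y => g y + g' y) := by
  obtain ⟨_, _, h1, h2, h3⟩ := h
  obtain ⟨_, _, h1', h2', h3'⟩ := h'
  exact ⟨_, _, h1.add h1', h2.add h2', h3.add h3'⟩

theorem HasPd.const_mul (c : ℝ) (h : HasPd A f g) :
    HasPd A (fun y => c * f y) (fun y => c * g y) :=
  ((hasPd_const A c).mul h).congr (fun _ _ => rfl) (fun _ _ => by ring)

theorem HasThirdPd.const_mul (c : ℝ) (h : HasThirdPd A B C f g) :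
    HasThirdPd A B C (fun y => c * f y) (fun y => c * g y) := by
  obtain ⟨_, _, h1, h2, h3⟩ := h
  exact ⟨_, _, h1.const_mul c, h2.const_mul c, h3.const_mul c⟩

theorem HasThirdPd.congr (h : HasThirdPd A B C f g) (hf : ∀ y, spatial y ≠ 0 → f' y = f y) :
    HasThirdPd A B C f' g := by
  obtain ⟨_, _, h1, h2, h3⟩ := h
  exact ⟨_, _, h1.congr hf (fun _ _ => rfl), h2, h3⟩

theorem HasThirdPd.eq (h : HasThirdPd A B C f g) {y : Coord n} (hy : spatial y ≠ 0) :
    pd A (pd B (pd C f)) y = g y := by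
  obtain ⟨_, _, h1, h2, h3⟩ := h
  exact (((h1.pd h2).pd h3) y hy).2

end

theorem hasThirdPd_coord_mul_coord (A B C i j : Fin (n + 1)) :
    HasThirdPd A B C (fun y => y i * y j) (fun _ => 0) := by
  refine ⟨_, _, (hasPd_coord C i).mul (hasPd_coord C j),
    ((hasPd_coord B i).mul (hasPd_const B _)).add ((hasPd_coord B j).mul (hasPd_const B _)),
    HasPd.congr (hasPd_const A ((if C = j then 1 else 0) * (if B = i then 1 else 0)
      + (if C = i then 1 else 0) * (if B = j then 1 else 0))) (fun y _ => ?_) (fun _ _ => rfl)⟩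
  simp

/-- All third partial derivatives vanish. -/
def IsQuadratic (f : Coord n → ℝ) : Prop := ∀ A B C, HasThirdPd A B C f (fun _ => 0)

section
variable {f f' : Coord n → ℝ}

theorem isQuadratic_coord_mul_coord (i j : Fin (n + 1)) :
    IsQuadratic (fun y : Coord n => y i * y j) :=
  fun A B C => hasThirdPd_coord_mul_coord A B C i j

theorem IsQuadratic.add (h : IsQuadratic f) (h' : IsQuadratic f') :
    IsQuadratic (fun y => f y + f' y) := fun A B C => by simpa using (h A B C).add (h' A B C)

theorem IsQuadratic.const_mul (c : ℝ) (h : IsQuadratic f) : IsQuadratic (fun y => c * f y) :=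
  fun A B C => by simpa using (h A B C).const_mul c

theorem IsQuadratic.congr (h : IsQuadratic f) (hf : ∀ y, spatial y ≠ 0 → f' y = f y) :
    IsQuadratic f' := fun A B C => (h A B C).congr hf

theorem IsQuadratic.sum {ι : Type*} (s : Finset ι) {f : ι → Coord n → ℝ}
    (h : ∀ i ∈ s, IsQuadratic (f i)) : IsQuadratic (fun y => ∑ i ∈ s, f i y) := by
  classical
  induction s using Finset.induction_on with
  | empty => exact fun A B C => ⟨_, _, hasPd_const _ _, hasPd_const _ _, hasPd_const _ _⟩
  | insert a s ha ih =>
    simp_rw [Finset.sum_insert ha]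
    exact (h a (Finset.mem_insert_self a s)).add
      (ih fun i hi => h i (Finset.mem_insert_of_mem hi))

theorem isQuadratic_norm_sq : IsQuadratic (fun y : Coord n => ‖spatial y‖ ^ 2) :=
  (IsQuadratic.sum Finset.univ fun i _ =>
    isQuadratic_coord_mul_coord (Fin.succ i) (Fin.succ i)).congr
    fun y _ => by simp_rw [norm_spatial_sq, pow_two]

theorem isQuadratic_coord_mul_axialComponent (x : Coord n) (r : ℝ) (A : Fin (n + 1)) :
    IsQuadratic (fun y : Coord n => y A * axialComponent x r y) :=
  (IsQuadratic.sum Finset.univ fun i _ =>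
    (isQuadratic_coord_mul_coord A (Fin.succ i)).const_mul (x i.succ / r)).congr fun y _ => by
      rw [axialComponent, Finset.mul_sum]
      exact Finset.sum_congr rfl fun k _ => by ring

/-- Every factor `|ȳ|` cancels against a denominator of `z` or occurs squared. This is why `β` must
have no constant term. -/
theorem isQuadratic_profileSpray {α β γ δ ε : ℝ → ℝ} {k₁ c₁ l k₂ k₃ k₄ c₄ : ℝ}
    (hα : ∀ z, α z = k₁ * z ^ 2 + c₁) (hβ : ∀ z, β z = l * z) (hγ : ∀ z, γ z = k₂ * z)
    (hδ : ∀ z, δ z = k₃) (hε : ∀ z, ε z = k₄ * z ^ 2 + c₄) (x : Coord n) (r : ℝ)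
    (A : Fin (n + 1)) : IsQuadratic (fun y => profileSpray α β γ δ ε x r y A) := by
  have h2 : ∀ (k c : ℝ) (h : ℝ → ℝ), (∀ z, h z = k * z ^ 2 + c) →
      IsQuadratic (fun y : Coord n => radial 2 h y) := fun k c h hh =>
    (((isQuadratic_coord_mul_coord 0 0).const_mul k).add
      (isQuadratic_norm_sq.const_mul c)).congr fun y hy => by
        have := (norm_spatial_pos hy).ne'
        rw [radial, hh, show ‖spatial y‖ ^ (2 : ℤ) = ‖spatial y‖ ^ 2 from rfl]
        field_simp
  have h1 : ∀ (k : ℝ) (h : ℝ → ℝ), (∀ z, h z = k * z) → ∀ y : Coord n, spatial y ≠ 0 →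
      radial 1 h y = k * y 0 := fun k h hh y hy => by
    have := (norm_spatial_pos hy).ne'
    rw [radial, hh, zpow_one]
    field_simp
  refine Fin.cases ?_ (fun j => ?_) A
  · refine ((h2 _ _ _ hα).add ((isQuadratic_coord_mul_axialComponent x r 0).const_mul k₂)).congr
      fun y hy => ?_
    simp only [profileSpray, Fin.cons_zero, h1 _ _ hγ y hy]
    ring
  · refine ((((isQuadratic_coord_mul_coord j.succ 0).const_mul l).add
      ((isQuadratic_coord_mul_axialComponent x r j.succ).const_mul k₃)).add
      ((h2 _ _ _ hε).const_mul (x j.succ / r))).congr fun y hy => ?_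
    simp only [profileSpray, Fin.cons_succ, h1 _ _ hβ y hy]
    simp [radial, hδ]
    ring

end

/-! ### Third derivatives at the test vectors -/

/-- `(yⁱ)^a (yʲ)^b |ȳ|^k h(y⁰/|ȳ|)`. -/
noncomputable def radialMonomial (i j : Fin n) (a b : ℕ) (k : ℤ) (h : ℝ → ℝ) (y : Coord n) : ℝ :=
  y i.succ ^ a * y j.succ ^ b * radial k h y

section
variable {i j : Fin n} {a b : ℕ} {k : ℤ} {h : ℝ → ℝ}

theorem hasPd_coord_pow (A B : Fin (n + 1)) (a : ℕ) : HasPd A (fun y : Coord n => y B ^ a)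
    (fun y => if A = B then a * y B ^ (a - 1) else 0) := fun y _ => by
  refine ⟨by fun_prop, ?_⟩
  rw [pd_comp (h := fun s => s ^ a) (g := fun w => w B) A (by fun_prop) (by fun_prop), pd_coord]
  simp

theorem hasPd_zero_radialMonomial (hh : Differentiable ℝ h) :
    HasPd 0 (radialMonomial i j a b k h) (radialMonomial i j a b (k - 1) (deriv h)) :=
  (((hasPd_coord_pow 0 i.succ a).mul (hasPd_coord_pow 0 j.succ b)).mul
    (hasPd_zero_radial k hh)).congr (fun _ _ => rfl) fun y _ => by
      simp [(Fin.succ_ne_zero _).symm, radialMonomial]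

/-- For `b = 0` the truncated exponent `b - 1` is harmless, its term having coefficient `b`. -/
theorem hasPd_succ_radialMonomial (hij : i ≠ j) (hh : Differentiable ℝ h) :
    HasPd j.succ (radialMonomial i j a b k h) (fun y => b * radialMonomial i j a (b - 1) k h y
      + radialMonomial i j a (b + 1) (k - 2) (fun z => k * h z - z * deriv h z) y) :=
  (((hasPd_coord_pow j.succ i.succ a).mul (hasPd_coord_pow j.succ j.succ b)).mul
    (hasPd_succ_radial j k hh)).congr (fun _ _ => rfl) fun y _ => by
      simp [Fin.succ_inj, hij.symm, radialMonomial]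
      ring

theorem hasPd_succ_radialMonomial_zero (hij : i ≠ j) (hh : Differentiable ℝ h) :
    HasPd j.succ (radialMonomial i j a 0 k h)
      (radialMonomial i j a 1 (k - 2) (fun z => k * h z - z * deriv h z)) :=
  (hasPd_succ_radialMonomial hij hh).congr (fun _ _ => rfl) fun y _ => by simp

theorem radialMonomial_axisPoint_zero (z : ℝ) :
    radialMonomial i j a 0 k h (axisPoint i z 1) = h z := by
  simp [radialMonomial, radial]

theorem radialMonomial_axisPoint_succ (hij : i ≠ j) (z : ℝ) :
    radialMonomial i j a (b + 1) k h (axisPoint i z 1) = 0 := by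
  simp [radialMonomial, hij.symm]

variable (i j a b k) in
theorem hasThirdPd_zero_zero_zero (hh : ContDiff ℝ ∞ h) :
    HasThirdPd 0 0 0 (radialMonomial i j a b k h)
      (radialMonomial i j a b (k - 1 - 1 - 1) (deriv (deriv (deriv h)))) := by
  have c1 := (contDiff_hasDerivAt hh).1
  have c2 := (contDiff_hasDerivAt c1).1
  exact ⟨_, _, hasPd_zero_radialMonomial (hh.differentiable (by simp)),
    hasPd_zero_radialMonomial (c1.differentiable (by simp)),
    hasPd_zero_radialMonomial (c2.differentiable (by simp))⟩

variable (a b k) in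
theorem hasThirdPd_succ_zero_zero (hij : i ≠ j) (hh : ContDiff ℝ ∞ h) :
    HasThirdPd j.succ 0 0 (radialMonomial i j a b k h)
      (fun y => b * radialMonomial i j a (b - 1) (k - 1 - 1) (deriv (deriv h)) y
        + radialMonomial i j a (b + 1) (k - 1 - 1 - 2) (fun z => ((k - 1 - 1 : ℤ) : ℝ)
          * deriv (deriv h) z - z * deriv (deriv (deriv h)) z) y) := by
  have c1 := (contDiff_hasDerivAt hh).1
  have c2 := (contDiff_hasDerivAt c1).1
  exact ⟨_, _, hasPd_zero_radialMonomial (hh.differentiable (by simp)),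
    hasPd_zero_radialMonomial (c1.differentiable (by simp)),
    hasPd_succ_radialMonomial hij (c2.differentiable (by simp))⟩

variable (k) in
theorem differentiable_mul_sub_mul_deriv (hh : ContDiff ℝ ∞ h) :
    Differentiable ℝ (fun z => (k : ℝ) * h z - z * deriv h z) :=
  ((hh.differentiable (by simp)).const_mul _).fun_sub
    (differentiable_id.fun_mul ((contDiff_hasDerivAt hh).1.differentiable (by simp)))

variable (a k) in
theorem exists_hasThirdPd_succ_succ_zero (hij : i ≠ j) (hh : ContDiff ℝ ∞ h) :
    ∃ g, HasThirdPd j.succ j.succ 0 (radialMonomial i j a 0 k h) g ∧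
      ∀ z, g (axisPoint i z 1) = (k - 1) * deriv h z - z * deriv (deriv h) z := by
  have c1 := (contDiff_hasDerivAt hh).1
  refine ⟨_, ⟨_, _, hasPd_zero_radialMonomial (hh.differentiable (by simp)),
    hasPd_succ_radialMonomial_zero hij (c1.differentiable (by simp)),
    hasPd_succ_radialMonomial (b := 1) hij (differentiable_mul_sub_mul_deriv (k - 1) c1)⟩, ?_⟩
  intro z
  rw [radialMonomial_axisPoint_succ hij, radialMonomial_axisPoint_zero]
  simp

variable (a k) in
theorem exists_hasThirdPd_succ_succ_succ_even (hij : i ≠ j) (hh : ContDiff ℝ ∞ h)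
    (hh1 : ContDiff ℝ ∞ (fun z => (k : ℝ) * h z - z * deriv h z)) :
    ∃ g, HasThirdPd j.succ j.succ j.succ (radialMonomial i j a 0 k h) g ∧
      ∀ z, g (axisPoint i z 1) = 0 := by
  refine ⟨_, ⟨_, _, hasPd_succ_radialMonomial_zero hij (hh.differentiable (by simp)),
    hasPd_succ_radialMonomial (b := 1) hij (differentiable_mul_sub_mul_deriv k hh),
    ((hasPd_succ_radialMonomial_zero hij (differentiable_mul_sub_mul_deriv k hh)).const_mul
      _).add (hasPd_succ_radialMonomial hij (differentiable_mul_sub_mul_deriv _ hh1))⟩, ?_⟩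
  intro z
  simp [radialMonomial_axisPoint_succ hij]

variable (a k) in
theorem exists_hasThirdPd_succ_succ_succ_odd (hij : i ≠ j) (hh : ContDiff ℝ ∞ h)
    (hh1 : ContDiff ℝ ∞ (fun z => (k : ℝ) * h z - z * deriv h z)) :
    ∃ g, HasThirdPd j.succ j.succ j.succ (radialMonomial i j a 1 k h) g ∧
      ∀ z, g (axisPoint i z 1) = 3 * (k * h z - z * deriv h z) := by
  have d1 := differentiable_mul_sub_mul_deriv k hh
  have d2 := differentiable_mul_sub_mul_deriv (k - 2) hh1
  -- The exponent `0 - 1` comes from a term with coefficient zero. At `yʲ = 0` only the terms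
  -- without a factor `yʲ` survive, with total weight `1 + 2 = 3`.
  refine ⟨_, ⟨_, _, (hasPd_succ_radialMonomial (b := 1) hij (hh.differentiable (by simp))),
    ((hasPd_succ_radialMonomial hij (hh.differentiable (by simp))).const_mul _).add
      (hasPd_succ_radialMonomial (b := 2) hij d1),
    ((((hasPd_succ_radialMonomial (b := 0 - 1) hij (hh.differentiable (by simp))).const_mul
      _).add (hasPd_succ_radialMonomial (b := 0 + 1) hij d1)).const_mul _).add
      (((hasPd_succ_radialMonomial (b := 1) hij d1).const_mul _).add
        (hasPd_succ_radialMonomial (b := 3) hij d2))⟩, ?_⟩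
  intro z
  simp [radialMonomial_axisPoint_zero, radialMonomial_axisPoint_succ hij (b := 0),
    radialMonomial_axisPoint_succ hij (b := 1),
    radialMonomial_axisPoint_succ hij (b := 3)]
  ring

end

/-! ### The Landsberg equations and the conclusion -/

section
variable {I : Set ℝ} {ρ : ℝ} {F : Coord n → Coord n → ℝ} {φ : ℝ → ℝ → ℝ → ℝ}

/-- At `y = (z, eᵢ)` the only nonzero `y`-derivatives of `F²` are those along `0` and `i`, so only
`G⁰` and `Gⁱ` enter. -/
theorem landsberg_axisPoint {ψ : ℝ → ℝ} (cψ : ContDiff ℝ ∞ ψ) {x : Coord n}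
    (hf : ∀ y, spatial y ≠ 0 → F x y ^ 2 = radial 2 ψ y) (i : Fin n) (z : ℝ)
    {A B C : Fin (n + 1)} {g₀ g₁ : Coord n → ℝ} (h₀ : HasThirdPd A B C (spray F 0 x) g₀)
    (h₁ : HasThirdPd A B C (spray F i.succ x) g₁)
    (h : landsberg F A B C x (axisPoint i z 1) = 0) :
    deriv ψ z * g₀ (axisPoint i z 1)
      + (2 * ψ z - z * deriv ψ z) * g₁ (axisPoint i z 1) = 0 := by
  have hy : spatial (axisPoint i z 1) ≠ 0 := spatial_axisPoint_ne one_ne_zero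
  have e0 := (hasPd_zero_radial_two cψ hf _ hy).2
  have ej := fun j => (hasPd_succ_radial_two cψ hf j _ hy).2
  rw [landsberg, Fin.sum_univ_succ, e0, h₀.eq hy] at h
  simp_rw [ej] at h
  rw [Finset.sum_eq_single i (fun j _ hj => by simp [hj]) (by simp), h₁.eq hy] at h
  simp [radial] at h
  exact h

theorem axialComponent_axisPoint (i : Fin n) (t b r : ℝ) (y : Coord n) :
    axialComponent (axisPoint i t b) r y = b / r * y i.succ := by
  rw [axialComponent, Finset.sum_eq_single i (fun j _ hj => by simp [hj]) (by simp)]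
  simp

/-- The second derivative at `0` equals `2m` computed from the right and `-2m` from the left. -/
theorem eq_zero_of_smooth_mul_abs {f : ℝ → ℝ} (hf : ContDiff ℝ ∞ f) {l m : ℝ}
    (h : ∀ s, s ≠ 0 → f s = l * s + m * (s * |s|)) : m = 0 := by
  obtain ⟨c1, d0⟩ := contDiff_hasDerivAt hf
  obtain ⟨c2, d1⟩ := contDiff_hasDerivAt c1
  have key : ∀ (m' : ℝ) (U : Set ℝ), IsOpen U → 0 ∈ closure U →
      (∀ s ∈ U, f s = l * s + m' * s ^ 2) → deriv (deriv f) 0 = 2 * m' := by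
    intro m' U hU h0 hs
    have h1 := deriv_congr_on hU hs d0 fun s =>
      ((hasDerivAt_id' s).const_mul l).fun_add ((hasDerivAt_pow 2 s).const_mul m')
    have h2 := deriv_congr_on hU h1 d1 fun s =>
      (hasDerivAt_const s (l * 1)).fun_add (((hasDerivAt_pow (2 - 1) s).const_mul _).const_mul m')
    have hc : IsClosed {s | deriv (deriv f) s = 2 * m'} :=
      isClosed_eq c2.continuous continuous_const
    refine hc.closure_subset_iff.2 (fun s hs => ?_) h0
    have := h2 s hs
    simp at this
    simp only [Set.mem_ofPred_eq]
    linarith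
  have hp := key m (Set.Ioi 0) isOpen_Ioi (by simp) fun s hs => by
    have hs' : (0 : ℝ) < s := hs
    rw [h s hs'.ne', abs_of_pos hs']
    ring
  have hm := key (-m) (Set.Iio 0) isOpen_Iio (by simp) fun s hs => by
    have hs' : s < 0 := hs
    rw [h s hs'.ne, abs_of_neg hs']
    ring
  linarith

theorem contDiff_comp_axisPoint_spatial (hI : IsOpen I) {f : Coord n × Coord n → ℝ}
    (hf : ContDiffOn ℝ ∞ f (cylinder n I ρ ×ˢ ({0}ᶜ : Set (Coord n)))) {x : Coord n}
    (hx : x ∈ cylinder n I ρ) (i : Fin n) : ContDiff ℝ ∞ fun s => f (x, axisPoint i 1 s) := by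
  rw [contDiff_iff_contDiffAt]
  intro s
  have h1 : ContDiffAt ℝ ∞ f (x, axisPoint i 1 s) := hf.contDiffAt ((isOpen_slit hI).mem_nhds
    ⟨hx, fun h => by simpa using congrFun h 0⟩)
  have h2 : ContDiff ℝ ∞ fun s : ℝ => (x, axisPoint i 1 s) := by
    simp_rw [axisPoint_eq]
    fun_prop
  exact h1.comp s h2.contDiffAt

theorem IsCylindrical.berwald_eq_zero (hI : IsOpen I)
    (hF : IsFinslerMetric (cylinder n I ρ) F) (hφ : IsCylindrical (cylinder n I ρ) F φ)
    (hL : IsLandsberg (cylinder n I ρ) F) {i j : Fin n} (hij : i ≠ j) {x : Coord n}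
    (hx : x ∈ cylinder n I ρ) (hxs : spatial x ≠ 0) {y : Coord n} (hy : spatial y ≠ 0)
    (A B C D : Fin (n + 1)) : berwald F A B C D x y = 0 := by
  obtain ⟨t, ht⟩ : ∃ t, x 0 = t := ⟨_, rfl⟩
  obtain ⟨r, hxr⟩ : ∃ r, ‖spatial x‖ = r := ⟨_, rfl⟩
  have hr : 0 < r := hxr ▸ norm_spatial_pos hxs
  -- All points with the same `t` and `r` share their profiles, so Landsberg conditions at axis
  -- points constrain the spray at `x`.
  have haxis : ∀ (k : Fin n) (b : ℝ), |b| = r → axisPoint k t b ∈ cylinder n I ρ := by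
    intro k b hb
    rw [mem_cylinder_iff] at hx ⊢
    rw [norm_spatial_axisPoint, hb, ← hxr]
    simpa [ht] using hx
  obtain ⟨ψ, hψ⟩ : ∃ ψ : ℝ → ℝ, ∀ z, ψ z = φ t r z ^ 2 := ⟨_, fun _ => rfl⟩
  have cψ : ContDiff ℝ ∞ ψ := by
    have := hφ.contDiff_sq hI hF i hx
    rwa [ht, hxr, ← funext hψ] at this
  have hf : ∀ x' ∈ cylinder n I ρ, x' 0 = t → ‖spatial x'‖ = r →
      ∀ y, spatial y ≠ 0 → F x' y ^ 2 = radial 2 ψ y := fun x' hx' h0 h1 y hy => by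
    rw [hφ.sq_eq_radial hx' hy, h0, h1, funext hψ]
  have hconv := radial_convexity cψ (hf x hx ht hxr) (hF.minkowski x hx) hij
  have pψ := fun z => (hconv z).1
  have pe := fun z => (hconv z).2.1
  have pψ2 := fun z => (hconv z).2.2.1
  obtain ⟨μ, ν, cμ, cν, hμν⟩ := hφ.exists_pd_fst hI hF i hr (haxis i r (abs_of_pos hr))
  obtain ⟨α, β, γ, δ, ε, ⟨cα, cβ, cγ, cδ, cε⟩, S1, S2, S3, S4, S5⟩ :=
    exists_spray_profiles cψ cμ cν pe fun z => (hconv z).2.2.2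
  have hspray : ∀ x' ∈ cylinder n I ρ, x' 0 = t → ‖spatial x'‖ = r → ∀ y, spatial y ≠ 0 →
      ∀ A, spray F A x' y = profileSpray α β γ δ ε x' r y A := fun x' hx' h0 h1 y hy A =>
    hφ.spray_eq hI hF cψ cμ cν hψ hx' h0 h1 (fun y hy => (hμν x' hx' h0 h1 y hy).1)
      (fun y hy => (hμν x' hx' h0 h1 y hy).2) S1 S2 S3 S4 S5 hy A
  have hy1 : ∀ z, spatial (axisPoint i z 1) ≠ 0 := fun z => spatial_axisPoint_ne one_ne_zero
  have hland : ∀ (k : Fin n) (b : ℝ), |b| = r → ∀ (A B C : Fin (n + 1)) (g₀ g₁ : Coord n → ℝ),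
      HasThirdPd A B C (spray F 0 (axisPoint k t b)) g₀ →
      HasThirdPd A B C (spray F i.succ (axisPoint k t b)) g₁ → ∀ z,
      deriv ψ z * g₀ (axisPoint i z 1)
        + (2 * ψ z - z * deriv ψ z) * g₁ (axisPoint i z 1) = 0 :=
    fun k b hb A B C g₀ g₁ h₀ h₁ z => landsberg_axisPoint cψ
      (hf _ (haxis k b hb) rfl (by simpa using hb)) i z h₀ h₁
      (hL _ (haxis k b hb) _ (ne_zero_of_spatial_ne (hy1 z)) A B C)
  have spray_i0 : ∀ s : ℝ, |s| = 1 → ∀ y, spatial y ≠ 0 → spray F 0 (axisPoint i t (s * r)) y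
      = radialMonomial i j 0 0 2 α y + s * radialMonomial i j 1 0 1 γ y := fun s hs y hy => by
    have hb : |s * r| = r := by rw [abs_mul, hs, one_mul, abs_of_pos hr]
    rw [hspray _ (haxis i _ hb) rfl (by simpa using hb) y hy, profileSpray, Fin.cons_zero,
      axialComponent_axisPoint, mul_div_cancel_right₀ _ hr.ne']
    simp only [radialMonomial]
    ring
  have spray_ii : ∀ s : ℝ, |s| = 1 → ∀ y, spatial y ≠ 0 →
      spray F i.succ (axisPoint i t (s * r)) y
      = radialMonomial i j 1 0 1 β y + s * radialMonomial i j 2 0 0 δ y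
        + s * radialMonomial i j 0 0 2 ε y := fun s hs y hy => by
    have hb : |s * r| = r := by rw [abs_mul, hs, one_mul, abs_of_pos hr]
    rw [hspray _ (haxis i _ hb) rfl (by simpa using hb) y hy, profileSpray, Fin.cons_succ,
      axialComponent_axisPoint, axisPoint_succ, if_pos rfl, mul_div_cancel_right₀ _ hr.ne']
    simp only [radialMonomial]
    ring
  have spray_j0 : ∀ y, spatial y ≠ 0 → spray F 0 (axisPoint j t r) y
      = radialMonomial i j 0 0 2 α y + radialMonomial i j 0 1 1 γ y := fun y hy => by
    rw [hspray _ (haxis j _ (abs_of_pos hr)) rfl (by simpa using hr.le) y hy, profileSpray,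
      Fin.cons_zero, axialComponent_axisPoint, div_self hr.ne']
    simp only [radialMonomial]
    ring
  have spray_ji : ∀ y, spatial y ≠ 0 → spray F i.succ (axisPoint j t r) y
      = radialMonomial i j 1 0 1 β y + radialMonomial i j 1 1 0 δ y := fun y hy => by
    rw [hspray _ (haxis j _ (abs_of_pos hr)) rfl (by simpa using hr.le) y hy, profileSpray,
      Fin.cons_succ, axialComponent_axisPoint, axisPoint_succ, if_neg hij, div_self hr.ne']
    simp only [radialMonomial]
    ring
  -- The factor `s = ±1` reverses `x̄`: the `α`, `β` terms are even in `s`, the `γ`, `δ`, `ε` terms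
  -- odd.
  have T000 : ∀ s : ℝ, |s| = 1 → ∀ z, deriv ψ z * (deriv (deriv (deriv α)) z
      + s * deriv (deriv (deriv γ)) z) + (2 * ψ z - z * deriv ψ z) *
      (deriv (deriv (deriv β)) z + s * deriv (deriv (deriv δ)) z
        + s * deriv (deriv (deriv ε)) z) = 0 := fun s hs z => by
    have := hland i (s * r) (by rw [abs_mul, hs, one_mul, abs_of_pos hr]) 0 0 0 _ _
      (((hasThirdPd_zero_zero_zero i j 0 0 2 cα).add
        ((hasThirdPd_zero_zero_zero i j 1 0 1 cγ).const_mul s)).congr (spray_i0 s hs))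
      ((((hasThirdPd_zero_zero_zero i j 1 0 1 cβ).add
        ((hasThirdPd_zero_zero_zero i j 2 0 0 cδ).const_mul s)).add
        ((hasThirdPd_zero_zero_zero i j 0 0 2 cε).const_mul s)).congr (spray_ii s hs)) z
    simpa only [radialMonomial_axisPoint_zero] using this
  have Tjj0 : ∀ s : ℝ, |s| = 1 → ∀ z, deriv ψ z * ((deriv α z - z * deriv (deriv α) z)
      + s * -(z * deriv (deriv γ) z)) + (2 * ψ z - z * deriv ψ z) *
      (-(z * deriv (deriv β) z) + s * (-deriv δ z - z * deriv (deriv δ) z)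
        + s * (deriv ε z - z * deriv (deriv ε) z)) = 0 := fun s hs z => by
    obtain ⟨gα, hα, eα⟩ := exists_hasThirdPd_succ_succ_zero 0 2 hij cα
    obtain ⟨gγ, hγ, eγ⟩ := exists_hasThirdPd_succ_succ_zero 1 1 hij cγ
    obtain ⟨gβ, hβ, eβ⟩ := exists_hasThirdPd_succ_succ_zero 1 1 hij cβ
    obtain ⟨gδ, hδ, eδ⟩ := exists_hasThirdPd_succ_succ_zero 2 0 hij cδ
    obtain ⟨gε, hε, eε⟩ := exists_hasThirdPd_succ_succ_zero 0 2 hij cε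
    have := hland i (s * r) (by rw [abs_mul, hs, one_mul, abs_of_pos hr]) j.succ j.succ 0 _ _
      ((hα.add (hγ.const_mul s)).congr (spray_i0 s hs))
      (((hβ.add (hδ.const_mul s)).add (hε.const_mul s)).congr (spray_ii s hs)) z
    simp only [eα, eβ, eγ, eδ, eε] at this
    push_cast at this
    linear_combination this
  -- With `x̄ = r eⱼ` one has `w = yʲ`, so an odd number of `∂ⱼ` at `yʲ = 0` removes `α` and `β` and
  -- isolates `γ` and `δ`.
  have B1 : ∀ z, deriv ψ z * deriv (deriv γ) z
      + (2 * ψ z - z * deriv ψ z) * deriv (deriv δ) z = 0 := fun z => by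
    have := hland j r (abs_of_pos hr) j.succ 0 0 _ _
      (((hasThirdPd_succ_zero_zero 0 0 2 hij cα).add
        (hasThirdPd_succ_zero_zero 0 1 1 hij cγ)).congr spray_j0)
      (((hasThirdPd_succ_zero_zero 1 0 1 hij cβ).add
        (hasThirdPd_succ_zero_zero 1 1 0 hij cδ)).congr spray_ji) z
    simp only [radialMonomial_axisPoint_succ hij, radialMonomial_axisPoint_zero, Nat.sub_self]
      at this
    push_cast at this
    linear_combination this
  have B2 : ∀ z, deriv ψ z * (γ z - z * deriv γ z)
      - (2 * ψ z - z * deriv ψ z) * (z * deriv δ z) = 0 := fun z => by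
    have cc : ∀ (k : ℤ) (h : ℝ → ℝ), ContDiff ℝ ∞ h →
        ContDiff ℝ ∞ fun z => (k : ℝ) * h z - z * deriv h z := fun k h hh => by
      have := (contDiff_hasDerivAt hh).1
      fun_prop
    obtain ⟨gα, hα, eα⟩ := exists_hasThirdPd_succ_succ_succ_even 0 2 hij cα (cc _ _ cα)
    obtain ⟨gγ, hγ, eγ⟩ := exists_hasThirdPd_succ_succ_succ_odd 0 1 hij cγ (cc _ _ cγ)
    obtain ⟨gβ, hβ, eβ⟩ := exists_hasThirdPd_succ_succ_succ_even 1 1 hij cβ (cc _ _ cβ)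
    obtain ⟨gδ, hδ, eδ⟩ := exists_hasThirdPd_succ_succ_succ_odd 1 0 hij cδ (cc _ _ cδ)
    have := hland j r (abs_of_pos hr) j.succ j.succ j.succ _ _
      ((hα.add hγ).congr spray_j0) ((hβ.add hδ).congr spray_ji) z
    simp only [eα, eβ, eγ, eδ] at this
    push_cast at this
    linear_combination (1 / 3) * this
  have one1 : |(1 : ℝ)| = 1 := abs_one
  have one2 : |(-1 : ℝ)| = 1 := by simp
  -- Half the sum of the cases `s = 1` and `s = -1` gives the even equations; half the difference
  -- gives the odd one below.
  obtain ⟨⟨k₁, c₁, hα⟩, l, m, hβ⟩ := landsberg_ode_symmetric cψ cμ cα cβ pψ pe pψ2 S1 S2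
    (fun z => by linear_combination 1 / 2 * T000 1 one1 z + 1 / 2 * T000 (-1) one2 z)
    (fun z => by linear_combination 1 / 2 * Tjj0 1 one1 z + 1 / 2 * Tjj0 (-1) one2 z)
  obtain ⟨⟨k₂, hγ⟩, ⟨k₃, hδ⟩, k₄, c₄, hε⟩ := landsberg_ode_axial cψ cν cγ cδ cε pψ pe pψ2
    S3 S4 S5 (fun z => by linear_combination 1 / 2 * Tjj0 1 one1 z - 1 / 2 * Tjj0 (-1) one2 z)
    B1 B2
  -- Take `x̄ = r eⱼ` and `y = (1, s eᵢ)`: the `δ` and `ε` terms vanish and `Gⁱ = ls + ms|s|`. The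
  -- curve crosses `ȳ = 0` at `s = 0` with `y ≠ 0`, so `Gⁱ` is smooth along it.
  have hm : m = 0 := by
    have hsm : ContDiff ℝ ∞ fun s => spray F i.succ (axisPoint j t r) (axisPoint i 1 s) :=
      contDiff_comp_axisPoint_spatial hI (contDiffOn_spray hI hF i.succ)
        (haxis j _ (abs_of_pos hr)) i
    refine eq_zero_of_smooth_mul_abs hsm (l := l) fun s hs => ?_
    rw [spray_ji _ (spatial_axisPoint_ne hs)]
    have := abs_pos.2 hs
    simp [radialMonomial, radial, hij.symm, hβ]
    field_simp
  have hβ' : ∀ z, β z = l * z := fun z => by rw [hβ, hm, add_zero]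
  have hq := isQuadratic_profileSpray hα hβ' hγ hδ hε x r A
  exact ((hq.congr fun y hy => hspray x hx ht hxr y hy A) B C D).eq hy

theorem dense_spatial_ne (i : Fin n) : Dense {x : Coord n | spatial x ≠ 0} := by
  have h : Dense ((fun x : Coord n => x i.succ) ⁻¹' {0}ᶜ) :=
    (dense_compl_singleton (0 : ℝ)).preimage (isOpenMap_eval i.succ)
  refine h.mono fun x (hx : x i.succ ≠ 0) h0 => hx ?_
  simpa [spatial] using congrArg (fun v : EuclideanSpace ℝ (Fin n) => v i) h0

/-- A nonzero value of the Berwald curvature would persist on an open set, which meets the dense set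
`x̄ ≠ 0`, `ȳ ≠ 0` where it is known to vanish. -/
theorem IsCylindrical.isBerwald_of_isLandsberg (hn : 2 ≤ n) (hI : IsOpen I)
    (hF : IsFinslerMetric (cylinder n I ρ) F) (hφ : IsCylindrical (cylinder n I ρ) F φ)
    (hL : IsLandsberg (cylinder n I ρ) F) : IsBerwald (cylinder n I ρ) F := by
  intro x hx y hy A B C D
  obtain ⟨i, j, hij⟩ : ∃ i j : Fin n, i ≠ j :=
    ⟨⟨0, by lia⟩, ⟨1, by lia⟩, by simp⟩
  have hU := isOpen_slit (n := n) (ρ := ρ) hI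
  have hopen := (continuousOn_berwald hI hF A B C D).isOpen_inter_preimage hU
    (isOpen_compl_singleton (x := (0 : ℝ)))
  by_contra hne
  obtain ⟨p, hp, hp'⟩ := ((dense_spatial_ne i).prod (dense_spatial_ne i)).inter_open_nonempty _
    hopen ⟨(x, y), ⟨hx, hy⟩, hne⟩
  exact hp.2 (hφ.berwald_eq_zero hI hF hL hij hp.1.1 hp'.1 hp'.2 A B C D)

end

theorem IsBerwald.isLandsberg {M : Set (Coord n)} {F : Coord n → Coord n → ℝ}
    (h : IsBerwald M F) : IsLandsberg M F := by
  intro x hx y hy A B C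
  have h0 : ∀ D, pd A (pd B (pd C (spray F D x))) y = 0 := fun D => h x hx y hy D A B C
  simp [landsberg, h0]

end Finsler

theorem mainTheorem1 (n : ℕ) (hn : 2 ≤ n) (I : Set ℝ) (hIopen : IsOpen I)
    (hIinterval : I.OrdConnected) (ρ : ℝ) (hρ : 0 < ρ)
    (F : Finsler.Coord n → Finsler.Coord n → ℝ)
    (hF : Finsler.IsFinslerMetric (Finsler.cylinder n I ρ) F)
    (φ : ℝ → ℝ → ℝ → ℝ)
    (hφ : ∀ x ∈ Finsler.cylinder n I ρ, ∀ y : Finsler.Coord n, Finsler.spatial y ≠ 0 →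
      F x y = ‖Finsler.spatial y‖ * φ (x 0) ‖Finsler.spatial x‖ (y 0 / ‖Finsler.spatial y‖)) :
    Finsler.IsLandsberg (Finsler.cylinder n I ρ) F ↔
      Finsler.IsBerwald (Finsler.cylinder n I ρ) F :=
  ⟨Finsler.IsCylindrical.isBerwald_of_isLandsberg hn hIopen hF hφ,
    Finsler.IsBerwald.isLandsberg⟩
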